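/- Let $p$ be a prime, let $\mathbb{Q}_p$ be the field of $p$-adic numbers with absolute value $|\cdot|_p$, and let $\chi(x)=\exp(2\pi i\{x\}_p)$ be its canonical additive character, where $\{x\}_p$ is the $p$-adic fractional part of $x$. The characteristic function of a probability measure $\mu$ on the Borel sets of $\mathbb{Q}_p$ is $\widehat\mu(t)=\int_{\mathbb{Q}_p}\chi(tx)\,\mu(dx)$. For a sequence $X_1,X_2,\dots$ of independent identically distributed $\mathbb{Q}_p$-valued random variables, nonzero $B_n\in\mathbb{Q}_p$ and an increasing sequence $k(n)$ of positive integers, put $$S_n=B_n^{-1}\bigl(X_1+\cdots+X_{k(n)}\bigr),\qquad \rho_n=\frac{k(n)}{k(n+1)},\qquad \gamma_n=\frac{B_n}{B_{n+1}},$$ and let $F_n$ be the distribution of $S_n$. Let $0<\beta<1$ and $\gamma_0\in\mathbb{Q}_p$ with $0\neq|\gamma_0|_p\le p^{-1}$. By a Lévy measure we mean a Borel measure $\Phi$ on $\mathbb{Q}_p\setminus\{0\}$ that is finite outside any neighbourhood of zero. Consider the conditions $$\Phi(M)=\beta\,\Phi(\gamma_0M)\quad\text{for every compact open } M\subset\mathbb{Q}_p\setminus\{0\},\tag{1}$$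 $$g(t)=\exp\int_{\mathbb{Q}_p\setminus\{0\}}\bigl(\chi(ty)-1\bigr)\,\Phi(dy),\qquad t\in\mathbb{Q}_p.\tag{2}$$ (i) If $\Phi$ is a Lévy measure satisfying (1), then the function $g$ given by (2) is the characteristic function of a probability distribution on $\mathbb{Q}_p$ that is the weak limit of the distributions $F_n$ for some choice of $(X_n)$, $(B_n)$, $(k(n))$ as above with $\rho_n\to\beta$ and $\gamma_n\to\gamma_0$. (ii) Conversely, suppose that the $X_n$ have a symmetric distribution (that is, $\mathbf{P}(X_n\in -M)=\mathbf{P}(X_n\in M)$ for all Borel $M$), that $|B_n|_p\to\infty$, $\gamma_n\to\gamma_0$, $\rho_n\to\beta$, and that $F_n$ converges weakly to a probability distribution $G$. Then the characteristic function of $G$ has the form (2), where $\Phi$ is a Lévy measure that is symmetric ($\Phi(-M)=\Phi(M)$ for all Borel $M$) and satisfies (1). -/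

import Mathlib

open MeasureTheory ProbabilityTheory Filter Topology
open scoped Pointwise

noncomputable section

namespace PadicLimit

variable {p : ℕ} [Fact p.Prime]

/-- The number of digits of `x` before the "p-adic point": it is `N` if `‖x‖ = p ^ N` with `N > 0`,
and `0` if `‖x‖ ≤ 1`. -/
def fractLength (x : ℚ_[p]) : ℕ := (-x.valuation).toNat

theorem norm_pow_fractLength_mul_le (x : ℚ_[p]) :
    ‖(p : ℚ_[p]) ^ fractLength x * x‖ ≤ 1 := by
  by_cases hx : x = 0
  · simp [hx]
  have hp : (1 : ℝ) < p := by exact_mod_cast (Fact.out : p.Prime).one_lt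
  rw [norm_mul, norm_pow, Padic.norm_p, Padic.norm_eq_zpow_neg_valuation hx, inv_pow,
    ← zpow_natCast, ← zpow_neg, ← zpow_add₀ (by positivity)]
  refine zpow_le_one_of_nonpos₀ hp.le ?_
  have := Int.self_le_toNat (-x.valuation)
  unfold fractLength
  omega

/-- The fractional part `{x}_p`. If `‖x‖ = p ^ N` with `N > 0` and
`x = p ^ (-N) * (x₀ + x₁ p + x₂ p ^ 2 + ⋯)` with digits `0 ≤ xᵢ < p`, it is
`p ^ (-N) * (x₀ + x₁ p + ⋯ + x_{N-1} p ^ (N-1))`; it is `0` if `‖x‖ ≤ 1`.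
(`PadicInt.appr z N` is the truncation of the digit expansion of `z` modulo `p ^ N`.) -/
def fract (x : ℚ_[p]) : ℝ :=
  (PadicInt.appr ⟨(p : ℚ_[p]) ^ fractLength x * x, norm_pow_fractLength_mul_le x⟩
    (fractLength x) : ℝ) / (p : ℝ) ^ fractLength x

/-- The canonical additive character `χ(x) = exp(2πi {x}_p)` of `ℚ_p`. -/
def chi (x : ℚ_[p]) : ℂ := Complex.exp (2 * Real.pi * Complex.I * (fract x : ℂ))

/-- The characteristic function `t ↦ ∫ χ(tx) μ(dx)` of a measure on `ℚ_p`. -/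
def charFn [MeasurableSpace ℚ_[p]] (μ : Measure ℚ_[p]) (t : ℚ_[p]) : ℂ :=
  ∫ x, chi (t * x) ∂μ

/-- A Borel measure on `ℚ_p ∖ {0}`, regarded as a measure on `ℚ_p` that does not charge `0`,
which is finite outside any neighbourhood of zero. -/
structure IsLevyMeasure [MeasurableSpace ℚ_[p]] (Φ : Measure ℚ_[p]) : Prop where
  zero_null : Φ {0} = 0
  finite_compl : ∀ U ∈ 𝓝 (0 : ℚ_[p]), Φ Uᶜ < ⊤

/-- The functional equation `Φ(M) = β Φ(γ₀ M)` for all compact open `M ⊆ ℚ_p ∖ {0}`. -/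
def ScalingRelation [MeasurableSpace ℚ_[p]] (Φ : Measure ℚ_[p]) (β : ℝ) (γ₀ : ℚ_[p]) : Prop :=
  ∀ M : Set ℚ_[p], IsCompact M → IsOpen M → (0 : ℚ_[p]) ∉ M →
    Φ M = ENNReal.ofReal β * Φ (γ₀ • M)

/-- `exp ∫_{ℚ_p ∖ {0}} (χ(ty) - 1) Φ(dy)`. -/
def levyExp [MeasurableSpace ℚ_[p]] (Φ : Measure ℚ_[p]) (t : ℚ_[p]) : ℂ :=
  Complex.exp (∫ y in {0}ᶜ, (chi (t * y) - 1) ∂Φ)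

/-- A measure is symmetric if `μ(-M) = μ(M)` for all Borel sets `M`. -/
def IsSymm [MeasurableSpace ℚ_[p]] (μ : Measure ℚ_[p]) : Prop :=
  ∀ M : Set ℚ_[p], MeasurableSet M → μ (-M) = μ M

/-- Independent identically distributed `ℚ_p`-valued random variables. -/
structure IsIID [MeasurableSpace ℚ_[p]] {Ω : Type*} [MeasurableSpace Ω] (P : Measure Ω)
    (X : ℕ → Ω → ℚ_[p]) : Prop where
  measurable : ∀ i, Measurable (X i)
  indep : iIndepFun X P
  ident : ∀ i j, IdentDistrib (X i) (X j) P P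

/-- The normalized sum of the first `k n` variables, `B_n⁻¹ (X_1 + ⋯ + X_{k(n)})`. -/
def normalizedSum {Ω : Type*} (X : ℕ → Ω → ℚ_[p]) (B : ℕ → ℚ_[p]) (k : ℕ → ℕ) (n : ℕ) (ω : Ω) :
    ℚ_[p] :=
  (B n)⁻¹ * ∑ i ∈ Finset.range (k n), X i ω

/-- The distributions `F_n` of the normalized sums converge weakly to the distribution `G`. -/
def SumsConvergeTo [MeasurableSpace ℚ_[p]] [BorelSpace ℚ_[p]] {Ω : Type*} [MeasurableSpace Ω]
    (P : Measure Ω) [IsProbabilityMeasure P] (X : ℕ → Ω → ℚ_[p]) (B : ℕ → ℚ_[p]) (k : ℕ → ℕ)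
    (G : Measure ℚ_[p]) [IsProbabilityMeasure G] : Prop :=
  TendstoInDistribution (normalizedSum X B k) atTop (id : ℚ_[p] → ℚ_[p]) (fun _ => P) G

end PadicLimit

end

noncomputable section

namespace PadicLimit

/-! ### The additive character -/

section

variable {p : ℕ} [Fact p.Prime]

/-! Everything rests on `χ` being trivial on the unit ball and on no larger ball. Averaging a
characteristic function over a ball therefore gives the mass of the dual ball
(`integral_charFn_unitHaar`). Balls form a π-system of clopen sets, so this one formula yields
uniqueness, tightness and the Lévy continuity theorem (`exists_tendsto_of_tendsto_charFn`). It also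
makes the integral in (2) see only the part of `Φ` off a small ball, where `Φ` is finite.

(i) Truncations of `Φ` give compound Poisson laws whose characteristic functions are, at each `t`,
eventually equal to `g(t)`; by continuity `g` belongs to a law `G`. Condition (1) says that the
exponent `ℓ = log g` satisfies `ℓ(γ₀t) = βℓ(t)`. Taking the `X_n` with law `G` itself, `B_n = γ₀⁻ⁿ`
and `k(n) ~ β⁻ⁿ`, the sum `S_n` has characteristic function `exp(k(n)βⁿℓ(t))`, which tends to
`g(t)`.

(ii) Symmetry makes all characteristic functions real. Comparing `S_n` with `S_{n+1}` gives `g(γ₀t)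
= g(t)^β`; hence `g` has no zeros and `g = exp(-ψ)` with `ψ(γ₀t) = βψ(t)`
(`SumsConvergeTo.exists_exponent`). The dilates `β⁻ⁿ(γ₀ⁿ)_*G` have exponents `-β⁻ⁿ(1 - exp(-βⁿψ))`,
which tend to `-ψ`, so they approximate the Lévy measure. A limit `ν` is taken only on the annulus
`|γ₀| < |y| ≤ 1`, a fundamental domain for multiplication by `γ₀`. `Φ` is then defined as the sum of
all dilates of `ν`, which makes (1) automatic, and dominated convergence over the shells identifies
its exponent as `-ψ` (`exists_levyMeasure_of_exponent`). -/

theorem exists_int_eq_of_norm_le_one {a : ℤ} {N : ℕ}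
    (h : ‖(a : ℚ_[p]) / (p : ℚ_[p]) ^ N‖ ≤ 1) : ∃ c : ℤ, a = p ^ N * c := by
  have hp : (0 : ℝ) < p := by exact_mod_cast (Fact.out : p.Prime).pos
  have : ‖(a : ℚ_[p])‖ ≤ (p : ℝ) ^ (-N : ℤ) := by
    rw [norm_div, norm_pow, Padic.norm_p, div_le_one (by positivity)] at h
    simpa [zpow_neg] using h
  exact (Padic.norm_int_le_pow_iff_dvd a N).1 this

theorem exists_fract_eq (x : ℚ_[p]) :
    ∃ (a : ℤ) (N : ℕ), fract x = (a : ℝ) / (p : ℝ) ^ N ∧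
      ‖x - (a : ℚ_[p]) / (p : ℚ_[p]) ^ N‖ ≤ 1 := by
  have hp : (0 : ℝ) < p := by exact_mod_cast (Fact.out : p.Prime).pos
  have hp' : (p : ℚ_[p]) ≠ 0 := by exact_mod_cast (Fact.out : p.Prime).ne_zero
  set N := fractLength x with hN
  set z : ℤ_[p] := ⟨(p : ℚ_[p]) ^ N * x, norm_pow_fractLength_mul_le x⟩ with hz
  refine ⟨(z.appr N : ℤ), N, by simp [fract, hz, hN], ?_⟩
  have h := PadicInt.appr_spec N z
  rw [← PadicInt.norm_le_pow_iff_mem_span_pow] at h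
  have h2 : ‖(p : ℚ_[p]) ^ N * x - (z.appr N : ℚ_[p])‖ ≤ (p : ℝ) ^ (-N : ℤ) := by
    have : ((z - (z.appr N : ℤ_[p]) : ℤ_[p]) : ℚ_[p])
        = (p : ℚ_[p]) ^ N * x - (z.appr N : ℚ_[p]) := by
      rw [PadicInt.coe_sub, PadicInt.coe_natCast]
    rw [← this]; exact h
  have h3 : x - ((z.appr N : ℤ) : ℚ_[p]) / (p : ℚ_[p]) ^ N
      = ((p : ℚ_[p]) ^ N * x - (z.appr N : ℚ_[p])) / (p : ℚ_[p]) ^ N := by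
    field_simp; simp
  rw [h3, norm_div, norm_pow, Padic.norm_p, div_le_one (by positivity)]
  simpa [zpow_neg] using h2

/-- `χ(x)` can be computed from any fraction `a / p ^ N` that agrees with `x` modulo `ℤ_p`. -/
theorem chi_eq_exp {x : ℚ_[p]} {a : ℤ} {N : ℕ}
    (h : ‖x - (a : ℚ_[p]) / (p : ℚ_[p]) ^ N‖ ≤ 1) :
    chi x = Complex.exp (2 * Real.pi * Complex.I * ((a : ℂ) / (p : ℂ) ^ N)) := by
  have hpC : (p : ℂ) ≠ 0 := by exact_mod_cast (Fact.out : p.Prime).ne_zero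
  have hp' : (p : ℚ_[p]) ≠ 0 := by exact_mod_cast (Fact.out : p.Prime).ne_zero
  obtain ⟨b, M, hb, hM⟩ := exists_fract_eq x
  have h1 : ‖((b * p ^ N - a * p ^ M : ℤ) : ℚ_[p]) / (p : ℚ_[p]) ^ (N + M)‖ ≤ 1 := by
    have : ((b * p ^ N - a * p ^ M : ℤ) : ℚ_[p]) / (p : ℚ_[p]) ^ (N + M)
        = (x - (a : ℚ_[p]) / (p : ℚ_[p]) ^ N) - (x - (b : ℚ_[p]) / (p : ℚ_[p]) ^ M) := by
      push_cast; field_simp; ring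
    rw [this, sub_eq_add_neg]
    exact (IsUltrametricDist.norm_add_le_max _ _).trans (max_le h (by rwa [norm_neg]))
  -- A fraction with denominator a power of `p` that is also a `p`-adic integer is an ordinary
  -- integer, so the two exponents differ by an element of `2πiℤ`.
  obtain ⟨c, hc⟩ := exists_int_eq_of_norm_le_one h1
  have hcC : (b : ℂ) * (p : ℂ) ^ N - a * (p : ℂ) ^ M = (p : ℂ) ^ (N + M) * c := by
    exact_mod_cast hc
  rw [chi, hb, Complex.exp_eq_exp_iff_exists_int]
  refine ⟨c, ?_⟩
  push_cast
  have : (b : ℂ) / (p : ℂ) ^ M = a / (p : ℂ) ^ N + c := by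
    field_simp
    rw [pow_add] at hcC
    linear_combination hcC
  rw [this]; ring

theorem chi_add (x y : ℚ_[p]) : chi (x + y) = chi x * chi y := by
  have hpC : (p : ℂ) ≠ 0 := by exact_mod_cast (Fact.out : p.Prime).ne_zero
  have hp' : (p : ℚ_[p]) ≠ 0 := by exact_mod_cast (Fact.out : p.Prime).ne_zero
  obtain ⟨a, N, -, ha⟩ := exists_fract_eq x
  obtain ⟨b, M, -, hb⟩ := exists_fract_eq y
  have h : ‖x + y - ((a * p ^ M + b * p ^ N : ℤ) : ℚ_[p]) / (p : ℚ_[p]) ^ (N + M)‖ ≤ 1 := by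
    have : x + y - ((a * p ^ M + b * p ^ N : ℤ) : ℚ_[p]) / (p : ℚ_[p]) ^ (N + M)
        = (x - (a : ℚ_[p]) / (p : ℚ_[p]) ^ N) + (y - (b : ℚ_[p]) / (p : ℚ_[p]) ^ M) := by
      push_cast; field_simp; ring
    rw [this]
    exact (IsUltrametricDist.norm_add_le_max _ _).trans (max_le ha hb)
  rw [chi_eq_exp h, chi_eq_exp ha, chi_eq_exp hb, ← Complex.exp_add]
  congr 1
  push_cast; field_simp; ring

theorem chi_eq_one {x : ℚ_[p]} (hx : ‖x‖ ≤ 1) : chi x = 1 := by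
  rw [chi_eq_exp (a := 0) (N := 0) (by simpa using hx)]
  simp

@[simp] theorem chi_zero : chi (0 : ℚ_[p]) = 1 := chi_eq_one (by simp)

@[simp] theorem norm_chi (x : ℚ_[p]) : ‖chi x‖ = 1 := by
  rw [chi, show (2 * Real.pi * Complex.I * (fract x : ℂ)) = ((2 * Real.pi * fract x : ℝ) : ℂ) *
    Complex.I by push_cast; ring]
  exact Complex.norm_exp_ofReal_mul_I _

theorem chi_neg (x : ℚ_[p]) : chi (-x) = starRingEnd ℂ (chi x) := by
  have h : chi (-x) * chi x = 1 := by rw [← chi_add]; simp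
  have h2 : starRingEnd ℂ (chi x) * chi x = 1 := by
    rw [mul_comm, Complex.mul_conj, Complex.normSq_eq_norm_sq]; simp
  have h3 : chi x ≠ 0 := by rw [← norm_ne_zero_iff]; simp
  exact mul_right_cancel₀ h3 (h.trans h2.symm)

theorem chi_inv_p_ne_one : chi ((p : ℚ_[p])⁻¹) ≠ 1 := by
  have hp := (Fact.out : p.Prime)
  have hpC : (p : ℂ) ≠ 0 := by exact_mod_cast hp.ne_zero
  rw [chi_eq_exp (a := 1) (N := 1) (by simp), Ne, Complex.exp_eq_one_iff]
  rintro ⟨n, hn⟩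
  have hπ : (2 * Real.pi * Complex.I : ℂ) ≠ 0 := Complex.two_pi_I_ne_zero
  have h1 : (1 : ℂ) = n * p := by
    rw [mul_comm (n : ℂ)] at hn
    have := mul_left_cancel₀ hπ hn
    field_simp at this
    simpa [mul_comm] using this
  have h2 : (1 : ℤ) = n * p := by exact_mod_cast h1
  have h3 : (p : ℤ) ∣ 1 := ⟨n, by rw [h2, mul_comm]⟩
  have := Int.le_of_dvd one_pos h3
  have := hp.two_le
  omega

/-- The multiplier `t = p⁻¹ / x` carries `x` to `p⁻¹`, where `χ` is not 1. This is the self-duality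
of the unit ball used for orthogonality. -/
theorem exists_norm_le_one_chi_mul_ne_one {x : ℚ_[p]} (hx : 1 < ‖x‖) :
    ∃ t : ℚ_[p], ‖t‖ ≤ 1 ∧ chi (t * x) ≠ 1 := by
  have hp := (Fact.out : p.Prime)
  have hp0 : (0 : ℝ) < p := by exact_mod_cast hp.pos
  have hx0 : x ≠ 0 := by rintro rfl; simp at hx; linarith
  refine ⟨(p : ℚ_[p])⁻¹ / x, ?_, ?_⟩
  · rw [norm_div, norm_inv, Padic.norm_p, inv_inv, div_le_one (by linarith)]
    by_contra! h
    -- The norm takes only powers of `p` as nonzero values, so `1 < ‖x‖` already forces `p ≤ ‖x‖`.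
    have := (Padic.norm_le_pow_iff_norm_lt_pow_add_one x 0).2 (by simpa using h)
    simp at this
    linarith
  · rw [div_mul_cancel₀ _ hx0]
    exact chi_inv_p_ne_one

theorem continuous_chi : Continuous (chi : ℚ_[p] → ℂ) := by
  rw [continuous_iff_continuousAt]
  intro x
  have : (fun _ => chi x) =ᶠ[𝓝 x] chi := by
    filter_upwards [Metric.closedBall_mem_nhds x one_pos] with y hy
    rw [show y = x + (y - x) by ring, chi_add, chi_eq_one (x := y - x), mul_one]
    simpa [dist_eq_norm] using hy
  exact continuousAt_const.congr this

/-! ### Balls of `ℚ_p` and their complements. -/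

theorem setOf_norm_mul_sub_le_one {c : ℚ_[p]} (hc : c ≠ 0) (a : ℚ_[p]) :
    {y | ‖c * (y - a)‖ ≤ 1} = Metric.closedBall a ‖c‖⁻¹ := by
  ext y
  have : 0 < ‖c‖ := norm_pos_iff.2 hc
  simp [dist_eq_norm, ← mul_comm ‖c‖, ← one_div, le_div_iff₀ this]

/-- The closed balls of `ℚ_p` with radius in the value group. -/
def ballSystem (p : ℕ) [Fact p.Prime] : Set (Set ℚ_[p]) :=
  {s | ∃ a c : ℚ_[p], c ≠ 0 ∧ s = Metric.closedBall a ‖c‖⁻¹}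

/-- In an ultrametric space two balls are nested or disjoint. -/
theorem isPiSystem_ballSystem : IsPiSystem (ballSystem p) := by
  rintro _ ⟨a, c, hc, rfl⟩ _ ⟨b, d, hd, rfl⟩ h
  rcases IsUltrametricDist.closedBall_subset_trichotomy (x := a) (y := b) (r := ‖c‖⁻¹) (s := ‖d‖⁻¹)
    with h1 | h1 | h1
  · exact ⟨a, c, hc, Set.inter_eq_left.2 h1⟩
  · exact ⟨b, d, hd, Set.inter_eq_right.2 h1⟩
  · exact absurd h1 (Set.not_disjoint_iff_nonempty_inter.2 h)

theorem exists_mem_ballSystem_subset {u : Set ℚ_[p]} (hu : IsOpen u) {x : ℚ_[p]} (hx : x ∈ u) :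
    ∃ s ∈ ballSystem p, s ∈ 𝓝 x ∧ s ⊆ u := by
  obtain ⟨r, hr, hru⟩ := Metric.isOpen_iff.1 hu x hx
  obtain ⟨c, hc⟩ := NormedField.exists_lt_norm ℚ_[p] r⁻¹
  have hc0 : 0 < ‖c‖ := (inv_pos.2 hr).trans hc
  refine ⟨_, ⟨x, c, norm_pos_iff.1 hc0, rfl⟩, Metric.closedBall_mem_nhds _ (inv_pos.2 hc0),
    (Metric.closedBall_subset_ball ?_).trans hru⟩
  exact inv_lt_of_inv_lt₀ hr hc

theorem isOpen_of_mem_ballSystem {s : Set ℚ_[p]} (hs : s ∈ ballSystem p) : IsOpen s := by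
  obtain ⟨a, c, hc, rfl⟩ := hs
  exact IsUltrametricDist.isOpen_closedBall _ (inv_ne_zero (norm_ne_zero_iff.2 hc))

theorem isCompact_of_mem_ballSystem {s : Set ℚ_[p]} (hs : s ∈ ballSystem p) : IsCompact s := by
  obtain ⟨a, c, hc, rfl⟩ := hs
  exact isCompact_closedBall _ _

/-- The complement of a ball around zero. -/
def outer (c : ℚ_[p]) : Set ℚ_[p] := {y | 1 < ‖c * y‖}

theorem isClosed_outer (c : ℚ_[p]) : IsClosed (outer c) := by
  rcases eq_or_ne c 0 with rfl | hc
  · simp [outer, not_lt.2 zero_le_one]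
  · have : outer c = (Metric.closedBall 0 ‖c‖⁻¹)ᶜ := by
      rw [← setOf_norm_mul_sub_le_one hc]; ext; simp [outer]
    rw [this, isClosed_compl_iff]
    exact IsUltrametricDist.isOpen_closedBall _ (inv_ne_zero (norm_ne_zero_iff.2 hc))

theorem isOpen_outer (c : ℚ_[p]) : IsOpen (outer c) :=
  isOpen_lt (by fun_prop) (by fun_prop)

theorem zero_notMem_outer (c : ℚ_[p]) : (0 : ℚ_[p]) ∉ outer c := by
  simp [outer]

theorem outer_subset_outer {s c : ℚ_[p]} (h : ‖s‖ ≤ ‖c‖) : outer s ⊆ outer c := fun y hy => by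
  simp only [outer, Set.mem_ofPred_eq, norm_mul] at hy ⊢
  exact hy.trans_le (by gcongr)

theorem chi_mul_eq_one_of_notMem_outer {t y : ℚ_[p]} (h : y ∉ outer t) : chi (t * y) = 1 :=
  chi_eq_one (not_lt.1 h)

end

/-! ### Fourier inversion and the Lévy continuity theorem -/

section

variable {p : ℕ} [Fact p.Prime] [MeasurableSpace ℚ_[p]]

theorem charFn_zero_eq (μ : Measure ℚ_[p]) : charFn μ 0 = μ.real Set.univ := by
  simp [charFn]

theorem charFn_zero (μ : Measure ℚ_[p]) [IsProbabilityMeasure μ] : charFn μ 0 = 1 := by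
  simp [charFn_zero_eq]

theorem norm_charFn_le (μ : Measure ℚ_[p]) [IsFiniteMeasure μ] (t : ℚ_[p]) :
    ‖charFn μ t‖ ≤ μ.real Set.univ := by
  simpa [charFn] using norm_integral_le_of_norm_le_const (μ := μ) (f := fun x => chi (t * x))
    (C := 1) (by simp)

theorem IsLevyMeasure.outer_lt_top {Φ : Measure ℚ_[p]} (hΦ : IsLevyMeasure Φ) (c : ℚ_[p]) :
    Φ (outer c) < ⊤ := by
  have := hΦ.finite_compl (outer c)ᶜ ((isClosed_outer c).isOpen_compl.mem_nhds
    (zero_notMem_outer c))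
  rwa [compl_compl] at this

/-- The Lévy exponent only sees the part of the measure outside a small ball. -/
theorem setIntegral_chi_sub_one (Φ : Measure ℚ_[p]) {t : ℚ_[p]} {E : Set ℚ_[p]}
    (hE : outer t ⊆ E) :
    ∫ y in E, (chi (t * y) - 1) ∂Φ = ∫ y, (chi (t * y) - 1) ∂Φ :=
  setIntegral_eq_integral_of_forall_compl_eq_zero fun y hy => by
    rw [chi_mul_eq_one_of_notMem_outer (fun h => hy (hE h)), sub_self]

/-- The Lévy exponent `∫ (χ(ty) - 1) Φ(dy)`. -/
def levyExponent (Φ : Measure ℚ_[p]) (t : ℚ_[p]) : ℂ := ∫ y, (chi (t * y) - 1) ∂Φ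

theorem levyExp_eq (Φ : Measure ℚ_[p]) (t : ℚ_[p]) :
    levyExp Φ t = Complex.exp (levyExponent Φ t) := by
  rw [levyExp, setIntegral_chi_sub_one, levyExponent]
  intro y hy h0
  rw [Set.mem_singleton_iff.1 h0] at hy
  exact zero_notMem_outer t hy

/-- Locally in `t`, this replaces a Lévy measure by a finite one, to which characteristic functions
apply. -/
theorem levyExponent_restrict (Φ : Measure ℚ_[p]) {t c : ℚ_[p]} (h : ‖t‖ ≤ ‖c‖) :
    levyExponent (Φ.restrict (outer c)) t = levyExponent Φ t :=
  setIntegral_chi_sub_one Φ (outer_subset_outer h)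

variable [BorelSpace ℚ_[p]]

@[fun_prop] theorem measurable_chi : Measurable (chi : ℚ_[p] → ℂ) := continuous_chi.measurable

theorem integrable_chi_mul (μ : Measure ℚ_[p]) [IsFiniteMeasure μ] (t : ℚ_[p]) :
    Integrable (fun x => chi (t * x)) μ :=
  Integrable.of_bound (Measurable.aestronglyMeasurable (by fun_prop)) 1 (by simp)

theorem continuous_charFn (μ : Measure ℚ_[p]) [IsFiniteMeasure μ] : Continuous (charFn μ) := by
  unfold charFn
  refine continuous_of_dominated (bound := fun _ => 1) ?_ (by simp) (integrable_const _) ?_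
  · exact fun t => Measurable.aestronglyMeasurable (by fun_prop)
  · exact .of_forall fun x => continuous_chi.comp (by fun_prop)

/-- The closed unit ball of `ℚ_p` as a compact set with nonempty interior. -/
def unitBall : TopologicalSpace.PositiveCompacts ℚ_[p] where
  carrier := Metric.closedBall 0 1
  isCompact' := isCompact_closedBall _ _
  interior_nonempty' := ⟨0, mem_interior_iff_mem_nhds.2 (Metric.closedBall_mem_nhds 0 one_pos)⟩

/-- The Haar probability measure on the closed unit ball of `ℚ_p`. -/
def unitHaar (p : ℕ) [Fact p.Prime] [MeasurableSpace ℚ_[p]] [BorelSpace ℚ_[p]] :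
    Measure ℚ_[p] :=
  (Measure.addHaarMeasure unitBall).restrict (Metric.closedBall 0 1)

instance : IsProbabilityMeasure (unitHaar p) := ⟨by
  rw [unitHaar, Measure.restrict_apply_univ]
  exact Measure.addHaarMeasure_self (K₀ := unitBall)⟩

theorem ae_unitHaar_norm_le_one : ∀ᵐ u ∂(unitHaar p), ‖u‖ ≤ 1 := by
  filter_upwards [ae_restrict_mem (s := Metric.closedBall (0 : ℚ_[p]) 1)
    (μ := Measure.addHaarMeasure unitBall) Metric.isClosed_closedBall.measurableSet] with u hu
  simpa using hu

/-- The unit ball is an additive subgroup, so translation by one of its elements preserves both the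
Haar measure and the ball. -/
theorem integral_unitHaar_add (f : ℚ_[p] → ℂ) {v : ℚ_[p]} (hv : ‖v‖ ≤ 1) :
    ∫ u, f (u + v) ∂(unitHaar p) = ∫ u, f u ∂(unitHaar p) := by
  have hB : MeasurableSet (Metric.closedBall (0 : ℚ_[p]) 1) :=
    Metric.isClosed_closedBall.measurableSet
  rw [unitHaar, ← integral_indicator hB, ← integral_indicator hB,
    ← integral_add_right_eq_self (Set.indicator _ f) v]
  congr 1 with u
  have hiff : u + v ∈ Metric.closedBall (0 : ℚ_[p]) 1 ↔ u ∈ Metric.closedBall (0 : ℚ_[p]) 1 := by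
    simp only [mem_closedBall_zero_iff]
    constructor
    · intro h
      have := IsUltrametricDist.norm_add_le_max (u + v) (-v)
      rw [add_neg_cancel_right, norm_neg] at this
      exact this.trans (max_le h hv)
    · exact fun h => (IsUltrametricDist.norm_add_le_max u v).trans (max_le h hv)
  by_cases h : u ∈ Metric.closedBall (0 : ℚ_[p]) 1
  · rw [Set.indicator_of_mem h, Set.indicator_of_mem (hiff.2 h)]
  · rw [Set.indicator_of_notMem h, Set.indicator_of_notMem (mt hiff.1 h)]

/-- Orthogonality of characters on the unit ball. -/
theorem integral_chi_unitHaar (y : ℚ_[p]) :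
    ∫ u, chi (u * y) ∂(unitHaar p) = {y : ℚ_[p] | ‖y‖ ≤ 1}.indicator 1 y := by
  by_cases hy : ‖y‖ ≤ 1
  · rw [Set.indicator_of_mem (by exact hy)]
    have : (fun u => chi (u * y)) =ᵐ[unitHaar p] fun _ => 1 := by
      filter_upwards [ae_unitHaar_norm_le_one] with u hu
      refine chi_eq_one ?_
      rw [norm_mul]
      exact mul_le_one₀ hu (norm_nonneg _) hy
    rw [integral_congr_ae this]
    simp
  · rw [Set.indicator_of_notMem (by exact hy)]
    obtain ⟨t, ht, htx⟩ := exists_norm_le_one_chi_mul_ne_one (not_le.1 hy)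
    -- Translating by `t` multiplies the integral by `χ(ty) ≠ 1`, so the integral vanishes.
    have h := integral_unitHaar_add (fun u => chi (u * y)) ht
    simp only [add_mul, chi_add, integral_mul_const] at h
    by_contra h0
    exact htx (mul_left_cancel₀ h0 (by rw [h, mul_one]))

/-- Fourier inversion on balls. -/
theorem integral_charFn_unitHaar (μ : Measure ℚ_[p]) [IsFiniteMeasure μ] (s c a : ℚ_[p]) :
    ∫ u, chi (-(c * u * a)) * charFn μ (s + c * u) ∂(unitHaar p)
      = ∫ y in {y | ‖c * (y - a)‖ ≤ 1}, chi (s * y) ∂μ := by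
  have hS : MeasurableSet {y : ℚ_[p] | ‖c * (y - a)‖ ≤ 1} := by
    exact measurableSet_le (by fun_prop) (by fun_prop)
  have h1 : ∀ u y : ℚ_[p], chi (-(c * u * a)) * chi ((s + c * u) * y)
      = chi (s * y) * chi (u * (c * (y - a))) := by
    intro u y
    rw [← chi_add, ← chi_add]; ring_nf
  simp only [charFn, ← integral_const_mul, h1]
  -- After Fubini the inner integral over `u` is, by orthogonality, the indicator of the ball.
  rw [integral_integral_swap]
  · simp only [integral_const_mul, integral_chi_unitHaar]
    rw [← integral_indicator hS]
    congr with y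
    by_cases hy : ‖c * (y - a)‖ ≤ 1
    · rw [Set.indicator_of_mem (by exact hy), Set.indicator_of_mem (by exact hy)]; simp
    · rw [Set.indicator_of_notMem (by exact hy), Set.indicator_of_notMem (by exact hy),
        mul_zero]
  · refine Integrable.of_bound (Measurable.aestronglyMeasurable ?_) 1
      (.of_forall fun z => by simp [Function.uncurry_def])
    simp only [Function.uncurry_def]
    fun_prop

theorem borel_eq_generateFrom_ballSystem :
    ‹MeasurableSpace ℚ_[p]› = MeasurableSpace.generateFrom (ballSystem p) := by
  have hB : TopologicalSpace.IsTopologicalBasis (ballSystem p) :=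
    TopologicalSpace.isTopologicalBasis_of_isOpen_of_nhds
      (fun s hs => isOpen_of_mem_ballSystem hs) fun x u hx hu => by
        obtain ⟨s, hs, hxs, hsu⟩ := exists_mem_ballSystem_subset hu hx
        exact ⟨s, hs, mem_of_mem_nhds hxs, hsu⟩
  rw [BorelSpace.measurable_eq (α := ℚ_[p]), hB.borel_eq_generateFrom]

/-- Finite measures that agree on balls are equal. -/
theorem ext_of_ballSystem {μ ν : Measure ℚ_[p]} [IsFiniteMeasure μ]
    (h : ∀ s ∈ ballSystem p, μ s = ν s) : μ = ν := by
  refine Measure.ext_of_generateFrom_of_iUnion (ballSystem p)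
    (fun n : ℕ => Metric.closedBall (0 : ℚ_[p]) ‖(p : ℚ_[p]) ^ n‖⁻¹)
    borel_eq_generateFrom_ballSystem isPiSystem_ballSystem ?_ ?_ (fun n => measure_ne_top _ _) h
  · refine Set.eq_univ_of_forall fun x => Set.mem_iUnion.2 ?_
    have hp : (1 : ℝ) < p := by exact_mod_cast (Fact.out : p.Prime).one_lt
    obtain ⟨n, hn⟩ := pow_unbounded_of_one_lt ‖x‖ hp
    exact ⟨n, by simpa using hn.le⟩
  · exact fun n => ⟨0, (p : ℚ_[p]) ^ n, pow_ne_zero _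
      (by exact_mod_cast (Fact.out : p.Prime).ne_zero), rfl⟩

/-- The untwisted case `s = 0` of the inversion formula. Its right side is stable under pointwise
bounded convergence of characteristic functions. -/
theorem ofReal_measureReal_closedBall (μ : Measure ℚ_[p]) [IsFiniteMeasure μ] {c : ℚ_[p]}
    (hc : c ≠ 0) (a : ℚ_[p]) :
    ((μ.real (Metric.closedBall a ‖c‖⁻¹) : ℝ) : ℂ)
      = ∫ u, chi (-(c * u * a)) * charFn μ (c * u) ∂(unitHaar p) := by
  have := integral_charFn_unitHaar μ 0 c a
  simp only [zero_add, zero_mul, chi_zero] at this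
  rw [this, setOf_norm_mul_sub_le_one hc]
  simp

/-- A finite measure is determined by its characteristic function. -/
theorem ext_of_charFn {μ ν : Measure ℚ_[p]} [IsFiniteMeasure μ] [IsFiniteMeasure ν]
    (h : ∀ t, charFn μ t = charFn ν t) : μ = ν := by
  refine ext_of_ballSystem ?_
  rintro _ ⟨a, c, hc, rfl⟩
  rw [← measureReal_eq_measureReal_iff]
  have := ofReal_measureReal_closedBall μ hc a
  simp only [h, ← ofReal_measureReal_closedBall ν hc a] at this
  exact_mod_cast this

/-- By inversion and dominated convergence the masses of balls converge; balls are a π-system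
containing small neighbourhoods of every point, which is enough for weak convergence. -/
theorem tendsto_of_tendsto_charFn {μ : ℕ → ProbabilityMeasure ℚ_[p]}
    {ν : ProbabilityMeasure ℚ_[p]}
    (h : ∀ t, Tendsto (fun n => charFn (μ n : Measure ℚ_[p]) t) atTop
      (𝓝 (charFn (ν : Measure ℚ_[p]) t))) :
    Tendsto μ atTop (𝓝 ν) := by
  refine isPiSystem_ballSystem.tendsto_probabilityMeasure_of_tendsto_of_mem
    (fun s hs => (isOpen_of_mem_ballSystem hs).measurableSet)
    (fun u hu x hx => exists_mem_ballSystem_subset hu hx) ?_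
  rintro _ ⟨a, c, hc, rfl⟩
  rw [← NNReal.tendsto_coe]
  have key : Tendsto (fun n => (((μ n : Measure ℚ_[p]).real (Metric.closedBall a ‖c‖⁻¹) : ℝ) : ℂ))
      atTop (𝓝 (((ν : Measure ℚ_[p]).real (Metric.closedBall a ‖c‖⁻¹) : ℝ) : ℂ)) := by
    simp only [ofReal_measureReal_closedBall _ hc]
    refine tendsto_integral_of_dominated_convergence (fun _ => 1) ?_ (integrable_const _) ?_ ?_
    · intro n
      have := (continuous_charFn (μ n : Measure ℚ_[p])).measurable
      exact Measurable.aestronglyMeasurable (by fun_prop)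
    · intro n
      refine .of_forall fun u => ?_
      rw [norm_mul, norm_chi, one_mul]
      simpa using norm_charFn_le (μ n : Measure ℚ_[p]) (c * u)
    · exact .of_forall fun u => (h _).const_mul _
  exact (Complex.continuous_re.tendsto _).comp key

theorem tendsto_charFn_of_tendsto {ι : Type*} {l : Filter ι} {μ : ι → ProbabilityMeasure ℚ_[p]}
    {ν : ProbabilityMeasure ℚ_[p]} (h : Tendsto μ l (𝓝 ν)) (t : ℚ_[p]) :
    Tendsto (fun n => charFn (μ n : Measure ℚ_[p]) t) l (𝓝 (charFn (ν : Measure ℚ_[p]) t)) := by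
  rw [ProbabilityMeasure.tendsto_iff_forall_integral_rclike_tendsto ℂ] at h
  exact h (BoundedContinuousFunction.ofNormedAddCommGroup (fun x => chi (t * x))
    (continuous_chi.comp (by fun_prop)) 1 (by simp))

/-- The mass of a large ball is the average of the characteristic function over a small ball, and
this tends to the average of `h`, which is close to `h 0 = 1`. -/
theorem isTightMeasureSet_of_tendsto_charFn {μ : ℕ → Measure ℚ_[p]}
    [∀ n, IsProbabilityMeasure (μ n)] {h : ℚ_[p] → ℂ} (hh : ContinuousAt h 0)
    (hlim : ∀ t, Tendsto (fun n => charFn (μ n) t) atTop (𝓝 (h t))) :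
    IsTightMeasureSet (Set.range μ) := by
  refine isTightMeasureSet_range_of_tendsto_limsup_measure_norm_gt ?_
  have h0 : h 0 = 1 := tendsto_nhds_unique (hlim 0) (by simp [charFn_zero])
  have hmeas : Measurable h := measurable_of_tendsto_metrizable
    (f := fun n => charFn (μ n)) (fun n => (continuous_charFn (μ n)).measurable)
    (tendsto_pi_nhds.2 hlim)
  rw [ENNReal.tendsto_atTop_zero]
  intro ε hε
  obtain ⟨δ, hδ, hδε⟩ : ∃ δ : ℝ, 0 < δ ∧ ENNReal.ofReal δ ≤ ε := by
    rcases eq_or_ne ε ⊤ with rfl | hε'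
    · exact ⟨1, one_pos, le_top⟩
    · exact ⟨ε.toReal, ENNReal.toReal_pos hε.ne' hε', ENNReal.ofReal_toReal_le⟩
  -- One half of `δ` pays for replacing `h` by 1 on the ball of radius `‖c‖`, the other for
  -- replacing the characteristic function by its limit.
  obtain ⟨η, hη, hball⟩ := Metric.continuousAt_iff.1 hh (δ / 2) (half_pos hδ)
  obtain ⟨c, hc0, hc⟩ := NormedField.exists_norm_lt ℚ_[p] hη
  have hcne : c ≠ 0 := norm_pos_iff.1 hc0
  have hT : Tendsto (fun n => ∫ u, charFn (μ n) (c * u) ∂(unitHaar p)) atTop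
      (𝓝 (∫ u, h (c * u) ∂(unitHaar p))) := by
    refine tendsto_integral_of_dominated_convergence (fun _ => 1) ?_ (integrable_const _) ?_ ?_
    · intro n
      have := (continuous_charFn (μ n)).measurable
      exact Measurable.aestronglyMeasurable (by fun_prop)
    · exact fun n => .of_forall fun u => by simpa using norm_charFn_le (μ n) (c * u)
    · exact .of_forall fun u => hlim _
  have hbound : ∀ᵐ u ∂(unitHaar p), ‖h (c * u) - 1‖ ≤ δ / 2 := by
    filter_upwards [ae_unitHaar_norm_le_one] with u hu
    have : dist (c * u) 0 < η := by
      rw [dist_zero_right, norm_mul]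
      exact (mul_le_of_le_one_right hc0.le hu).trans_lt hc
    have := hball this
    rw [h0, dist_eq_norm] at this
    exact this.le
  have hI : ‖∫ u, h (c * u) ∂(unitHaar p) - 1‖ ≤ δ / 2 := by
    have hint : Integrable (fun u => h (c * u)) (unitHaar p) := by
      refine Integrable.of_bound (Measurable.aestronglyMeasurable (by fun_prop)) (δ / 2 + 1) ?_
      filter_upwards [hbound] with u hu
      calc ‖h (c * u)‖ = ‖(h (c * u) - 1) + 1‖ := by ring_nf
        _ ≤ _ := (norm_add_le _ _).trans (by simpa using hu)
    have : ∫ u, h (c * u) ∂(unitHaar p) - 1 = ∫ u, (h (c * u) - 1) ∂(unitHaar p) := by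
      rw [integral_sub hint (integrable_const _)]; simp
    rw [this]
    simpa using norm_integral_le_of_norm_le_const hbound
  refine ⟨‖c‖⁻¹, fun r hr => ?_⟩
  refine (limsup_le_of_le (by isBoundedDefault) ?_).trans hδε
  filter_upwards [hT.eventually (Metric.ball_mem_nhds _ (half_pos hδ))] with n hn
  have e1 : ∫ u, charFn (μ n) (c * u) ∂(unitHaar p)
      = ((μ n).real (Metric.closedBall 0 ‖c‖⁻¹) : ℂ) := by
    rw [ofReal_measureReal_closedBall (μ n) hcne 0]; simp
  rw [e1, dist_eq_norm] at hn
  have e2 : 1 - (μ n).real (Metric.closedBall 0 ‖c‖⁻¹) ≤ δ := by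
    have h3 : ‖((μ n).real (Metric.closedBall 0 ‖c‖⁻¹) : ℂ) - 1‖ ≤ δ := by
      calc _ = ‖(((μ n).real (Metric.closedBall 0 ‖c‖⁻¹) : ℂ) - ∫ u, h (c * u) ∂(unitHaar p))
            + (∫ u, h (c * u) ∂(unitHaar p) - 1)‖ := by ring_nf
        _ ≤ δ / 2 + δ / 2 := (norm_add_le _ _).trans (add_le_add hn.le hI)
        _ = δ := by ring
    have h4 : ‖((μ n).real (Metric.closedBall 0 ‖c‖⁻¹) : ℂ) - 1‖
        = |(μ n).real (Metric.closedBall 0 ‖c‖⁻¹) - 1| := by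
      rw [← Complex.ofReal_one, ← Complex.ofReal_sub, Complex.norm_real, Real.norm_eq_abs]
    rw [h4, abs_sub_comm] at h3
    exact (le_abs_self _).trans h3
  have hmb : MeasurableSet (Metric.closedBall (0 : ℚ_[p]) ‖c‖⁻¹) :=
    Metric.isClosed_closedBall.measurableSet
  calc μ n {x | r < ‖x‖} ≤ μ n (Metric.closedBall 0 ‖c‖⁻¹)ᶜ := by
        refine measure_mono fun x hx => ?_
        simp only [Set.mem_compl_iff, mem_closedBall_zero_iff, not_le]
        exact lt_of_le_of_lt hr hx
    _ = ENNReal.ofReal ((μ n).real (Metric.closedBall 0 ‖c‖⁻¹)ᶜ) := by simp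
    _ ≤ ENNReal.ofReal δ := by
        rw [measureReal_compl hmb, probReal_univ]
        exact ENNReal.ofReal_le_ofReal e2

/-- The **Lévy continuity theorem** on `ℚ_p`. -/
theorem exists_tendsto_of_tendsto_charFn {μ : ℕ → ProbabilityMeasure ℚ_[p]} {h : ℚ_[p] → ℂ}
    (hh : ContinuousAt h 0)
    (hlim : ∀ t, Tendsto (fun n => charFn (μ n : Measure ℚ_[p]) t) atTop (𝓝 (h t))) :
    ∃ ν : ProbabilityMeasure ℚ_[p], (∀ t, charFn (ν : Measure ℚ_[p]) t = h t) ∧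
      Tendsto μ atTop (𝓝 ν) := by
  have htight := isTightMeasureSet_of_tendsto_charFn hh hlim
  have hcomp : IsCompact (closure (Set.range μ)) :=
    isCompact_closure_of_isTightMeasureSet (htight.subset (by
      simp [Set.subset_def]))
  -- Any limit along a nonprincipal ultrafilter has characteristic function `h`; convergence of the
  -- whole sequence then follows from `tendsto_of_tendsto_charFn`.
  obtain ⟨ν, -, hν⟩ := hcomp.ultrafilter_le_nhds ((hyperfilter ℕ).map μ)
    (le_principal_iff.2 (Filter.mem_map.2 (Filter.univ_mem' fun n => subset_closure ⟨n, rfl⟩)))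
  have hν' : Tendsto μ (hyperfilter ℕ) (𝓝 ν) := hν
  have hle : (hyperfilter ℕ : Filter ℕ) ≤ atTop := by
    rw [← Nat.cofinite_eq_atTop]; exact hyperfilter_le_cofinite
  have hchar : ∀ t, charFn (ν : Measure ℚ_[p]) t = h t := fun t =>
    tendsto_nhds_unique (tendsto_charFn_of_tendsto hν' t) ((hlim t).mono_left hle)
  exact ⟨ν, hchar, tendsto_of_tendsto_charFn fun t => by rw [hchar]; exact hlim t⟩

end

/-! ### Normalized sums, compound Poisson distributions and existence -/

section

variable {p : ℕ} [Fact p.Prime] [MeasurableSpace ℚ_[p]] [BorelSpace ℚ_[p]]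

theorem charFn_map_const_mul (μ : Measure ℚ_[p]) (c t : ℚ_[p]) :
    charFn (μ.map (c * ·)) t = charFn μ (t * c) := by
  unfold charFn
  rw [integral_map (by fun_prop) (Measurable.aestronglyMeasurable (by fun_prop))]
  simp [mul_assoc]

theorem charFn_conv (μ ν : Measure ℚ_[p]) [IsFiniteMeasure μ] [IsFiniteMeasure ν] (t : ℚ_[p]) :
    charFn (μ ∗ ν) t = charFn μ t * charFn ν t := by
  unfold charFn Measure.conv
  rw [integral_map (by fun_prop) (Measurable.aestronglyMeasurable (by fun_prop)),
    ← integral_prod_mul]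
  simp [mul_add, chi_add]

/-- The characteristic function of a normalized sum of i.i.d. variables. -/
theorem charFn_map_normalizedSum {Ω : Type*} [MeasurableSpace Ω] {P : Measure Ω}
    {X : ℕ → Ω → ℚ_[p]} (hX : IsIID P X) (B : ℕ → ℚ_[p]) (k : ℕ → ℕ) (n : ℕ) (t : ℚ_[p]) :
    charFn (P.map (normalizedSum X B k n)) t = charFn (P.map (X 0)) (t * (B n)⁻¹) ^ k n := by
  have hm := hX.measurable
  have hS : Measurable (normalizedSum X B k n) := by unfold normalizedSum; fun_prop
  have hind : iIndepFun (fun i : Fin (k n) => X i) P := hX.indep.precomp Fin.val_injective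
  have h := hind.integral_fun_prod_comp (𝕜 := ℂ) (f := fun _ x => chi (t * (B n)⁻¹ * x))
    (fun i => (hm i).aemeasurable) (fun i => Measurable.aestronglyMeasurable (by fun_prop))
  have hsum : ∀ (s : ℚ_[p]) (m : ℕ) (ω : Ω), chi (s * ∑ i ∈ Finset.range m, X i ω)
      = ∏ i ∈ Finset.range m, chi (s * X i ω) := by
    intro s m ω
    induction m with
    | zero => simp
    | succ m ih => rw [Finset.sum_range_succ, Finset.prod_range_succ, mul_add, chi_add, ih]
  have hid : ∀ i, ∫ ω, chi (t * (B n)⁻¹ * X i ω) ∂P = charFn (P.map (X 0)) (t * (B n)⁻¹) := by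
    intro i
    rw [← (hX.ident i 0).map_eq, charFn, integral_map (hm i).aemeasurable
      (Measurable.aestronglyMeasurable (by fun_prop))]
  rw [charFn, integral_map hS.aemeasurable (Measurable.aestronglyMeasurable (by fun_prop))]
  simp only [normalizedSum, ← mul_assoc, hsum, Finset.prod_range]
  rw [h]
  simp [hid]

/-- Convolution powers of a measure. -/
def convPow (ν : Measure ℚ_[p]) : ℕ → Measure ℚ_[p]
  | 0 => Measure.dirac 0
  | n + 1 => ν ∗ convPow ν n

instance (ν : Measure ℚ_[p]) [IsFiniteMeasure ν] (n : ℕ) : IsFiniteMeasure (convPow ν n) := by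
  induction n with
  | zero => unfold convPow; infer_instance
  | succ n ih => unfold convPow; infer_instance

theorem charFn_convPow (ν : Measure ℚ_[p]) [IsFiniteMeasure ν] (n : ℕ) (t : ℚ_[p]) :
    charFn (convPow ν n) t = charFn ν t ^ n := by
  induction n with
  | zero => simp [convPow, charFn]
  | succ n ih => rw [convPow, charFn_conv, ih, pow_succ']

theorem measureReal_univ_convPow (ν : Measure ℚ_[p]) [IsFiniteMeasure ν] (n : ℕ) :
    (convPow ν n).real Set.univ = ν.real Set.univ ^ n := by
  have h := charFn_convPow ν n 0
  rw [charFn_zero_eq, charFn_zero_eq] at h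
  exact_mod_cast h

/-- The exponential series `∑ ν^{*n} / n!` of a measure. -/
def convExp (ν : Measure ℚ_[p]) : Measure ℚ_[p] :=
  Measure.sum fun n => ENNReal.ofReal (n.factorial : ℝ)⁻¹ • convPow ν n

theorem convExp_univ (ν : Measure ℚ_[p]) [IsFiniteMeasure ν] :
    convExp ν Set.univ = ENNReal.ofReal (Real.exp (ν.real Set.univ)) := by
  have hs := Real.summable_pow_div_factorial (ν.real Set.univ)
  rw [convExp, Measure.sum_apply _ MeasurableSet.univ, Real.exp_eq_exp_ℝ,
    NormedSpace.exp_eq_tsum_div, ENNReal.ofReal_tsum_of_nonneg (fun n => by positivity) hs]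
  congr with n
  rw [Measure.smul_apply, smul_eq_mul, div_eq_inv_mul, ENNReal.ofReal_mul (by positivity),
    ← measureReal_univ_convPow, ofReal_measureReal]

instance (ν : Measure ℚ_[p]) [IsFiniteMeasure ν] : IsFiniteMeasure (convExp ν) :=
  ⟨by rw [convExp_univ]; exact ENNReal.ofReal_lt_top⟩

theorem charFn_convExp (ν : Measure ℚ_[p]) [IsFiniteMeasure ν] (t : ℚ_[p]) :
    charFn (convExp ν) t = Complex.exp (charFn ν t) := by
  have h := hasSum_integral_measure (integrable_chi_mul (convExp ν) t)
  simp only [integral_smul_measure, ENNReal.toReal_ofReal (inv_nonneg.2 (Nat.cast_nonneg _))] at h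
  rw [charFn, Complex.exp_eq_exp_ℂ, NormedSpace.exp_eq_tsum_div, convExp, ← h.tsum_eq]
  congr with n
  have := charFn_convPow ν n t
  rw [charFn] at this
  rw [this, Complex.real_smul, div_eq_inv_mul]
  push_cast
  rfl

/-- The compound Poisson distribution with a given finite Lévy measure. -/
def compoundPoisson (ν : Measure ℚ_[p]) : Measure ℚ_[p] :=
  ENNReal.ofReal (Real.exp (-ν.real Set.univ)) • convExp ν

instance (ν : Measure ℚ_[p]) [IsFiniteMeasure ν] : IsProbabilityMeasure (compoundPoisson ν) :=
  ⟨by rw [compoundPoisson, Measure.smul_apply, convExp_univ, smul_eq_mul,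
        ← ENNReal.ofReal_mul (by positivity), ← Real.exp_add]; simp⟩

theorem charFn_compoundPoisson (ν : Measure ℚ_[p]) [IsFiniteMeasure ν] (t : ℚ_[p]) :
    charFn (compoundPoisson ν) t = Complex.exp (∫ y, (chi (t * y) - 1) ∂ν) := by
  have h := charFn_convExp ν t
  rw [charFn] at h
  rw [integral_sub (integrable_chi_mul ν t) (integrable_const _), charFn, compoundPoisson,
    integral_smul_measure, h, ENNReal.toReal_ofReal (by positivity), Complex.real_smul,
    Complex.ofReal_exp, ← Complex.exp_add]
  congr 1
  simp [charFn]; ring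

/-! ### Lévy measures -/

theorem measurableSet_outer (c : ℚ_[p]) : MeasurableSet (outer c) :=
  measurableSet_lt (by fun_prop) (by fun_prop)

theorem levyExponent_eq_charFn_sub (ν : Measure ℚ_[p]) [IsFiniteMeasure ν] (t : ℚ_[p]) :
    levyExponent ν t = charFn ν t - ν.real Set.univ := by
  rw [levyExponent, integral_sub (integrable_chi_mul ν t) (integrable_const _)]
  simp [charFn]

/-- On the unit ball the exponent is that of the finite measure `Φ` restricted to `outer 1`, hence a
characteristic function up to a constant. -/
theorem IsLevyMeasure.continuousAt_levyExponent {Φ : Measure ℚ_[p]} (hΦ : IsLevyMeasure Φ) :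
    ContinuousAt (levyExponent Φ) 0 := by
  have : IsFiniteMeasure (Φ.restrict (outer 1)) :=
    ⟨by rw [Measure.restrict_apply_univ]; exact hΦ.outer_lt_top 1⟩
  have hc : ContinuousAt (levyExponent (Φ.restrict (outer 1))) 0 := by
    have := continuous_charFn (Φ.restrict (outer 1))
    simp only [funext (levyExponent_eq_charFn_sub (Φ.restrict (outer 1)))]
    fun_prop
  refine hc.congr ?_
  filter_upwards [Metric.closedBall_mem_nhds (0 : ℚ_[p]) one_pos] with t ht
  exact levyExponent_restrict Φ (by simpa using ht)

/-- Every Lévy measure is the Lévy measure of a probability distribution. -/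
theorem IsLevyMeasure.exists_charFn_eq {Φ : Measure ℚ_[p]} (hΦ : IsLevyMeasure Φ) :
    ∃ G : ProbabilityMeasure ℚ_[p], ∀ t, charFn (G : Measure ℚ_[p]) t = levyExp Φ t := by
  have hfin : ∀ c, IsFiniteMeasure (Φ.restrict (outer c)) := fun c =>
    ⟨by rw [Measure.restrict_apply_univ]; exact hΦ.outer_lt_top c⟩
  -- The truncation keeps the part of `Φ` on `‖y‖ > p⁻ⁿ`. Once `‖t‖ ≤ pⁿ` it has the full exponent
  -- at `t`, so each sequence of values is eventually constant.
  let μ : ℕ → ProbabilityMeasure ℚ_[p] := fun n =>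
    ⟨compoundPoisson (Φ.restrict (outer ((p : ℚ_[p]) ^ n)⁻¹)), inferInstance⟩
  have hp : (1 : ℝ) < p := by exact_mod_cast (Fact.out : p.Prime).one_lt
  have hcont : ContinuousAt (levyExp Φ) 0 := by
    rw [funext (levyExp_eq Φ)]
    exact hΦ.continuousAt_levyExponent.cexp
  suffices hlim : ∀ t, Tendsto (fun n => charFn (μ n : Measure ℚ_[p]) t) atTop
      (𝓝 (levyExp Φ t)) by
    obtain ⟨G, hG, -⟩ := exists_tendsto_of_tendsto_charFn hcont hlim
    exact ⟨G, hG⟩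
  intro t
  obtain ⟨N, hN⟩ := pow_unbounded_of_one_lt ‖t‖ hp
  refine tendsto_const_nhds.congr' ?_
  filter_upwards [eventually_ge_atTop N] with n hn
  have : ‖t‖ ≤ ‖((p : ℚ_[p]) ^ n)⁻¹‖ := by
    simp only [norm_inv, norm_pow, Padic.norm_p, inv_pow, inv_inv]
    exact hN.le.trans (pow_le_pow_right₀ hp.le hn)
  rw [levyExp_eq, ← levyExponent_restrict Φ this, levyExponent, ← charFn_compoundPoisson]
  rfl

/-- The scaling relation is given only on compact open sets avoiding 0. Balls intersected with
`outer t` are such sets, so the image of `Φ` under `γ₀` and `β • Φ` agree on `outer t`, the only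
part the exponent at `t` sees. -/
theorem ScalingRelation.levyExponent_mul {Φ : Measure ℚ_[p]} (hΦ : IsLevyMeasure Φ) {β : ℝ}
    (hβ : 0 ≤ β) {γ₀ : ℚ_[p]} (hγ₀ : γ₀ ≠ 0) (h : ScalingRelation Φ β γ₀) (t : ℚ_[p]) :
    levyExponent Φ (t * γ₀) = β * levyExponent Φ t := by
  have hms : ∀ s : Set ℚ_[p], (γ₀ * ·) ⁻¹' s = γ₀⁻¹ • s := fun s => by
    rw [← Set.preimage_smul₀ hγ₀]; rfl
  have hfin : IsFiniteMeasure ((Φ.map (γ₀ * ·)).restrict (outer t)) := by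
    refine ⟨?_⟩
    rw [Measure.restrict_apply_univ, Measure.map_apply (by fun_prop) (measurableSet_outer t)]
    convert hΦ.outer_lt_top (t * γ₀) using 2
    ext; simp [outer, mul_assoc]
  have key : (Φ.map (γ₀ * ·)).restrict (outer t)
      = (ENNReal.ofReal β • Φ).restrict (outer t) := by
    refine ext_of_ballSystem fun s hs => ?_
    have hso := isOpen_of_mem_ballSystem hs
    have hsc := isCompact_of_mem_ballSystem hs
    rw [Measure.restrict_apply hso.measurableSet, Measure.restrict_apply hso.measurableSet,
      Measure.map_apply (by fun_prop) (hso.measurableSet.inter (measurableSet_outer t)), hms,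
      h (γ₀⁻¹ • (s ∩ outer t)) ?_ ?_ ?_, smul_inv_smul₀ hγ₀, Measure.smul_apply, smul_eq_mul]
    · exact (hsc.inter_right (isClosed_outer t)).smul _
    · exact (hso.inter (isOpen_outer t)).smul₀ (inv_ne_zero hγ₀)
    · rw [← hms]
      simp [zero_notMem_outer]
  have e1 : levyExponent Φ (t * γ₀) = levyExponent (Φ.map (γ₀ * ·)) t := by
    rw [levyExponent, levyExponent, integral_map (by fun_prop)
      (Measurable.aestronglyMeasurable (by fun_prop))]
    simp [mul_assoc]
  rw [e1, ← levyExponent_restrict _ le_rfl, key, levyExponent_restrict _ le_rfl, levyExponent,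
    integral_smul_measure, ENNReal.toReal_ofReal hβ, Complex.real_smul, levyExponent]

theorem ScalingRelation.levyExponent_mul_pow {Φ : Measure ℚ_[p]} (hΦ : IsLevyMeasure Φ) {β : ℝ}
    (hβ : 0 ≤ β) {γ₀ : ℚ_[p]} (hγ₀ : γ₀ ≠ 0) (h : ScalingRelation Φ β γ₀) (t : ℚ_[p]) (n : ℕ) :
    levyExponent Φ (t * γ₀ ^ n) = β ^ n * levyExponent Φ t := by
  induction n with
  | zero => simp
  | succ n ih => rw [pow_succ, ← mul_assoc, h.levyExponent_mul hΦ hβ hγ₀, ih]; ring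

/-- The summand `n` makes `k` strictly increasing, which the ceiling alone need not be; it is
harmless because `nβⁿ → 0`. -/
theorem tendsto_ceil_inv_pow_add_mul_pow {β : ℝ} (hβ₀ : 0 < β) (hβ₁ : β < 1) :
    Tendsto (fun n : ℕ => ((⌈(β ^ n)⁻¹⌉₊ + n : ℕ) : ℝ) * β ^ n) atTop (𝓝 1) := by
  have h1 : Tendsto (fun n : ℕ => (n : ℝ) * β ^ n) atTop (𝓝 0) :=
    tendsto_self_mul_const_pow_of_lt_one hβ₀.le hβ₁
  have h2 : Tendsto (fun n : ℕ => β ^ n) atTop (𝓝 0) :=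
    tendsto_pow_atTop_nhds_zero_of_lt_one hβ₀.le hβ₁
  refine tendsto_of_tendsto_of_tendsto_of_le_of_le tendsto_const_nhds
    (h := fun n : ℕ => 1 + β ^ n + n * β ^ n) (by simpa using (h2.const_add 1).add h1) ?_ ?_
  · intro n
    have hn : 0 < β ^ n := pow_pos hβ₀ n
    have := Nat.le_ceil (β ^ n)⁻¹
    calc (1 : ℝ) = (β ^ n)⁻¹ * β ^ n := (inv_mul_cancel₀ hn.ne').symm
      _ ≤ _ := by
        push_cast
        gcongr
        linarith [(Nat.cast_nonneg n : (0 : ℝ) ≤ n)]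
  · intro n
    have hn : 0 < β ^ n := pow_pos hβ₀ n
    have := (Nat.ceil_lt_add_one (inv_nonneg.2 hn.le)).le
    calc ((⌈(β ^ n)⁻¹⌉₊ + n : ℕ) : ℝ) * β ^ n ≤ (((β ^ n)⁻¹ + 1) + n) * β ^ n := by
          push_cast; gcongr
      _ = _ := by field_simp

/-- A Lévy measure with the scaling property arises from normalized sums. -/
theorem exists_sumsConvergeTo {β : ℝ} (hβ₀ : 0 < β) (hβ₁ : β < 1) {γ₀ : ℚ_[p]} (hγ₀ : γ₀ ≠ 0)
    {Φ : Measure ℚ_[p]} (hΦ : IsLevyMeasure Φ) (hs : ScalingRelation Φ β γ₀) :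
    ∃ (G : Measure ℚ_[p]) (_ : IsProbabilityMeasure G),
      (∀ t, charFn G t = levyExp Φ t) ∧
      ∃ (Ω : Type) (_ : MeasurableSpace Ω) (P : Measure Ω) (_ : IsProbabilityMeasure P)
        (X : ℕ → Ω → ℚ_[p]) (B : ℕ → ℚ_[p]) (k : ℕ → ℕ),
        IsIID P X ∧ (∀ n, B n ≠ 0) ∧ (∀ n, 0 < k n) ∧ StrictMono k ∧
        Tendsto (fun n => (k n : ℝ) / (k (n + 1) : ℝ)) atTop (𝓝 β) ∧
        Tendsto (fun n => B n / B (n + 1)) atTop (𝓝 γ₀) ∧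
        SumsConvergeTo P X B k G := by
  obtain ⟨G, hG⟩ := hΦ.exists_charFn_eq
  -- The variables get the limit law `G` itself. Then `B n / B (n + 1)` equals `γ₀` exactly, and
  -- only `k n * β ^ n → 1` is needed.
  set k : ℕ → ℕ := fun n => ⌈(β ^ n)⁻¹⌉₊ + n with hk
  set B : ℕ → ℚ_[p] := fun n => (γ₀ ^ n)⁻¹ with hB
  set P : Measure (ℕ → ℚ_[p]) := Measure.infinitePi fun _ => (G : Measure ℚ_[p]) with hP
  set X : ℕ → (ℕ → ℚ_[p]) → ℚ_[p] := fun i ω => ω i with hX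
  have hXmap : ∀ i, P.map (X i) = G := fun i => Measure.infinitePi_map_eval _ i
  have hXm : ∀ i, Measurable (X i) := fun i => measurable_pi_apply i
  have hiid : IsIID P X := by
    refine ⟨hXm, ?_, fun i j => ⟨(hXm i).aemeasurable, (hXm j).aemeasurable, ?_⟩⟩
    · exact iIndepFun_infinitePi (X := fun _ x => x) (fun _ => measurable_id)
    · rw [hXmap, hXmap]
  have hlim : Tendsto (fun n => (k n : ℝ) * β ^ n) atTop (𝓝 1) :=
    tendsto_ceil_inv_pow_add_mul_pow hβ₀ hβ₁
  have hkpos : ∀ n, 0 < k n := fun n =>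
    Nat.add_pos_left (Nat.ceil_pos.2 (inv_pos.2 (pow_pos hβ₀ n))) n
  refine ⟨G, inferInstance, hG, _, _, P, inferInstance, X, B, k, hiid,
    fun n => inv_ne_zero (pow_ne_zero n hγ₀), hkpos, ?_, ?_, ?_, ?_⟩
  · refine strictMono_nat_of_lt_succ fun n => ?_
    have h1 : (β ^ n)⁻¹ ≤ (β ^ (n + 1))⁻¹ := by
      refine inv_anti₀ (pow_pos hβ₀ _) (pow_le_pow_of_le_one hβ₀.le hβ₁.le n.le_succ)
    have := Nat.ceil_mono h1
    simp only [hk]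
    omega
  · have h2 : Tendsto (fun n => (k n * β ^ n) / (k (n + 1) * β ^ (n + 1)) * β) atTop (𝓝 β) := by
      simpa using (hlim.div (hlim.comp (tendsto_add_atTop_nat 1)) one_ne_zero).mul_const β
    refine h2.congr fun n => ?_
    have h3 : (k (n + 1) : ℝ) ≠ 0 := Nat.cast_ne_zero.2 (hkpos _).ne'
    field_simp
    ring
  · refine tendsto_const_nhds.congr fun n => ?_
    simp only [hB]
    field_simp
    ring
  · refine ⟨fun n => ?_, aemeasurable_id, ?_⟩
    · exact Measurable.aemeasurable (by unfold normalizedSum; fun_prop)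
    · refine tendsto_of_tendsto_charFn fun t => ?_
      simp only [ProbabilityMeasure.coe_mk, Measure.map_id]
      simp only [charFn_map_normalizedSum hiid, hXmap, hG, levyExp_eq]
      simp only [hB, inv_inv, hs.levyExponent_mul_pow hΦ hβ₀.le hγ₀, ← Complex.exp_nat_mul]
      have h2 : Tendsto (fun n => (((k n : ℝ) * β ^ n : ℝ) : ℂ) * levyExponent Φ t) atTop
          (𝓝 (levyExponent Φ t)) := by
        simpa using ((Complex.continuous_ofReal.tendsto _).comp hlim).mul_const (levyExponent Φ t)
      refine (h2.cexp).congr fun n => ?_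
      push_cast
      rw [mul_assoc]

end

/-! ### The characteristic function of a limit distribution -/

section

variable {p : ℕ} [Fact p.Prime] [MeasurableSpace ℚ_[p]]

theorem charFn_neg (μ : Measure ℚ_[p]) (t : ℚ_[p]) :
    charFn μ (-t) = starRingEnd ℂ (charFn μ t) := by
  simp only [charFn, neg_mul, chi_neg]
  exact integral_conj

variable [BorelSpace ℚ_[p]]

theorem charFn_map_neg (μ : Measure ℚ_[p]) (t : ℚ_[p]) :
    charFn (μ.map Neg.neg) t = charFn μ (-t) := by
  rw [charFn, integral_map (by fun_prop) (Measurable.aestronglyMeasurable (by fun_prop))]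
  simp [charFn]

theorem IsSymm.conj_charFn {μ : Measure ℚ_[p]} (h : IsSymm μ) (t : ℚ_[p]) :
    starRingEnd ℂ (charFn μ t) = charFn μ t := by
  have hmap : μ.map Neg.neg = μ := by
    ext s hs
    rw [Measure.map_apply measurable_neg hs]
    exact h s hs
  rw [← charFn_neg, ← charFn_map_neg, hmap]

theorem isSymm_of_conj_charFn {μ : Measure ℚ_[p]} [IsFiniteMeasure μ]
    (h : ∀ t, starRingEnd ℂ (charFn μ t) = charFn μ t) : IsSymm μ := by
  have hmap : μ.map Neg.neg = μ := ext_of_charFn fun t => by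
    rw [charFn_map_neg, charFn_neg, h]
  intro s hs
  conv_rhs => rw [← hmap, Measure.map_apply measurable_neg hs]
  rfl

theorem SumsConvergeTo.tendsto_charFn {Ω : Type*} [MeasurableSpace Ω] {P : Measure Ω}
    [IsProbabilityMeasure P] {X : ℕ → Ω → ℚ_[p]} {B : ℕ → ℚ_[p]} {k : ℕ → ℕ} {G : Measure ℚ_[p]}
    [IsProbabilityMeasure G] (h : SumsConvergeTo P X B k G) (t : ℚ_[p]) :
    Tendsto (fun n => charFn (P.map (normalizedSum X B k n)) t) atTop (𝓝 (charFn G t)) := by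
  have := tendsto_charFn_of_tendsto h.tendsto t
  simpa using this

/-- Slutsky's theorem: `c n * S_n` converges in distribution when `c n` converges to a constant.
This allows the argument of the characteristic function to move with `n`. -/
theorem SumsConvergeTo.tendsto_charFn_mul {Ω : Type*} [MeasurableSpace Ω] {P : Measure Ω}
    [IsProbabilityMeasure P] {X : ℕ → Ω → ℚ_[p]} {B : ℕ → ℚ_[p]} {k : ℕ → ℕ} {G : Measure ℚ_[p]}
    [IsProbabilityMeasure G] (h : SumsConvergeTo P X B k G) {c : ℕ → ℚ_[p]} {c₀ : ℚ_[p]}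
    (hc : Tendsto c atTop (𝓝 c₀)) (t : ℚ_[p]) :
    Tendsto (fun n => charFn (P.map (normalizedSum X B k n)) (t * c n)) atTop
      (𝓝 (charFn G (t * c₀))) := by
  have hcm : TendstoInMeasure P (fun n (_ : Ω) => c n) atTop (fun _ => c₀) :=
    tendstoInMeasure_of_tendsto_ae (fun n => aestronglyMeasurable_const) (.of_forall fun _ => hc)
  have h2 := TendstoInDistribution.continuous_comp_prodMk_of_tendstoInMeasure_const
    (g := fun z : ℚ_[p] × ℚ_[p] => z.2 * z.1) (by fun_prop) h hcm (fun n => aemeasurable_const)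
  have := tendsto_charFn_of_tendsto h2.tendsto t
  simp only [ProbabilityMeasure.coe_mk, id] at this
  rw [charFn_map_const_mul] at this
  refine this.congr fun n => ?_
  rw [← charFn_map_const_mul, AEMeasurable.map_map_of_aemeasurable (by fun_prop)
    (h.forall_aemeasurable n)]
  rfl

/-- The characteristic function of the limit distribution is `exp (-ψ)` with a continuous
nonnegative `ψ` that satisfies `ψ(γ₀ t) = β ψ(t)`. -/
theorem SumsConvergeTo.exists_exponent {β : ℝ} (hβ₀ : 0 < β) {γ₀ : ℚ_[p]} (hγ₁ : ‖γ₀‖ < 1)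
    {Ω : Type*} [MeasurableSpace Ω] {P : Measure Ω} [IsProbabilityMeasure P]
    {X : ℕ → Ω → ℚ_[p]} {B : ℕ → ℚ_[p]} {k : ℕ → ℕ} {G : Measure ℚ_[p]} [IsProbabilityMeasure G]
    (hX : IsIID P X) (hsymm : ∀ i, IsSymm (P.map (X i))) (hB : ∀ n, B n ≠ 0)
    (hk : ∀ n, 0 < k n) (hBtop : Tendsto (fun n => ‖B n‖) atTop atTop)
    (hρ : Tendsto (fun n => (k n : ℝ) / (k (n + 1) : ℝ)) atTop (𝓝 β))
    (hγ : Tendsto (fun n => B n / B (n + 1)) atTop (𝓝 γ₀)) (h : SumsConvergeTo P X B k G) :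
    ∃ ψ : ℚ_[p] → ℝ, Continuous ψ ∧ (∀ t, 0 ≤ ψ t) ∧ (∀ t, ψ (t * γ₀) = β * ψ t) ∧
      ∀ t, charFn G t = Real.exp (-ψ t) := by
  have hprob : IsProbabilityMeasure (P.map (X 0)) :=
    Measure.isProbabilityMeasure_map (hX.measurable 0).aemeasurable
  set φ : ℚ_[p] → ℝ := fun t => (charFn (P.map (X 0)) t).re with hφ
  have hφeq : ∀ t, charFn (P.map (X 0)) t = φ t := fun t =>
    (Complex.conj_eq_iff_re.1 ((hsymm 0).conj_charFn t)).symm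
  have hφc : Continuous φ := Complex.continuous_re.comp (continuous_charFn _)
  have hφ0 : φ 0 = 1 := by simp [hφ, charFn_zero]
  set g : ℚ_[p] → ℝ := fun t => (charFn G t).re with hg
  have hgc : Continuous g := Complex.continuous_re.comp (continuous_charFn _)
  have hg0 : g 0 = 1 := by simp [hg, charFn_zero]
  have hS : ∀ n t, charFn (P.map (normalizedSum X B k n)) t = (φ (t * (B n)⁻¹) ^ k n : ℝ) := by
    intro n t
    rw [charFn_map_normalizedSum hX, hφeq]
    push_cast; rfl
  have hT := h.tendsto_charFn
  simp only [hS] at hT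
  have hTre : ∀ t, Tendsto (fun n => φ (t * (B n)⁻¹) ^ k n) atTop (𝓝 (g t)) := fun t =>
    (Complex.continuous_re.tendsto _).comp (hT t)
  have hgeq : ∀ t, charFn G t = g t := fun t =>
    tendsto_nhds_unique (hT t) ((Complex.continuous_ofReal.tendsto _).comp (hTre t))
  -- The value at `t` of `φ(·/B_{n+1})^{k(n)}` is the characteristic function of `S_n` at `tγ_n`.
  have hTγ : ∀ t, Tendsto (fun n => φ (t * (B (n + 1))⁻¹) ^ k n) atTop (𝓝 (g (t * γ₀))) := by
    intro t
    have h1 := h.tendsto_charFn_mul hγ t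
    simp only [hS] at h1
    refine ((Complex.continuous_re.tendsto _).comp h1).congr fun n => ?_
    simp only [Function.comp_apply, Complex.ofReal_re]
    congr 2
    field_simp [hB n, hB (n + 1)]
  have hBinv : Tendsto (fun n => (B n)⁻¹) atTop (𝓝 0) := by
    rw [tendsto_zero_iff_norm_tendsto_zero]
    simp only [norm_inv]
    exact hBtop.inv_tendsto_atTop
  -- Since `|B_n| → ∞`, the base tends to `φ(0) = 1`; once it is nonnegative, real powers obey the
  -- usual laws.
  have hpos : ∀ t, ∀ᶠ n in atTop, 0 ≤ φ (t * (B n)⁻¹) := by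
    intro t
    have h1 : Tendsto (fun n => φ (t * (B n)⁻¹)) atTop (𝓝 1) := by
      rw [← hφ0]
      refine (hφc.tendsto 0).comp ?_
      simpa using hBinv.const_mul t
    filter_upwards [h1.eventually (eventually_gt_nhds one_pos)] with n hn using hn.le
  have hgnn : ∀ t, 0 ≤ g t := fun t => ge_of_tendsto (hTre t) (by
    filter_upwards [hpos t] with n hn using pow_nonneg hn _)
  have hgle : ∀ t, g t ≤ 1 := fun t => by
    have := (Complex.re_le_norm (charFn G t)).trans (norm_charFn_le G t)
    simpa using this
  -- Raising `φ(t/B_{n+1})^{k(n)}` to the power `k(n+1)/k(n)` gives the characteristic function of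
  -- `S_{n+1}`. The limit of the base may still be 0 here; positivity of `β⁻¹` keeps the power
  -- continuous there.
  have hfun : ∀ t, g t = g (t * γ₀) ^ β⁻¹ := by
    intro t
    have hexp : Tendsto (fun n => (k (n + 1) : ℝ) / k n) atTop (𝓝 β⁻¹) := by
      simpa using hρ.inv₀ hβ₀.ne'
    have h1 := (hTγ t).rpow hexp (Or.inr (inv_pos.2 hβ₀))
    refine tendsto_nhds_unique ((hTre t).comp (tendsto_add_atTop_nat 1)) (h1.congr' ?_)
    filter_upwards [(tendsto_add_atTop_nat 1).eventually (hpos t)] with n hn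
    have hkn : (k n : ℝ) ≠ 0 := Nat.cast_ne_zero.2 (hk n).ne'
    rw [← Real.rpow_natCast, ← Real.rpow_mul hn, mul_div_cancel₀ _ hkn, Real.rpow_natCast]
    rfl
  have hfun' : ∀ t, g (t * γ₀) = g t ^ β := by
    intro t
    rw [hfun t, ← Real.rpow_mul (hgnn _), inv_mul_cancel₀ hβ₀.ne', Real.rpow_one]
  have hgpos : ∀ t, 0 < g t := by
    intro t
    -- A zero at `t` would propagate to all `tγ₀ⁿ → 0`, against `g(0) = 1` and continuity.
    refine (hgnn t).lt_of_ne fun h0 => ?_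
    have hz : ∀ n : ℕ, g (t * γ₀ ^ n) = 0 := by
      intro n
      induction n with
      | zero => simp [← h0]
      | succ n ih => rw [pow_succ, ← mul_assoc, hfun', ih, Real.zero_rpow hβ₀.ne']
    have h1 : Tendsto (fun n : ℕ => g (t * γ₀ ^ n)) atTop (𝓝 1) := by
      rw [← hg0]
      refine (hgc.tendsto 0).comp ?_
      simpa using (tendsto_pow_atTop_nhds_zero_of_norm_lt_one hγ₁).const_mul t
    simp only [hz] at h1
    exact zero_ne_one (tendsto_nhds_unique tendsto_const_nhds h1)
  refine ⟨fun t => -Real.log (g t), ?_, fun t => ?_, fun t => ?_, fun t => ?_⟩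
  · exact (hgc.log fun t => (hgpos t).ne').neg
  · exact neg_nonneg.2 (Real.log_nonpos (hgnn t) (hgle t))
  · simp only [hfun', Real.log_rpow (hgpos t)]; ring
  · rw [neg_neg, Real.exp_log (hgpos t), hgeq]

end

/-! ### Dilations -/

section

variable {p : ℕ} [Fact p.Prime]

/-- A fundamental domain for the multiplication by `γ` on `ℚ_p ∖ {0}`. -/
def annulus (γ : ℚ_[p]) : Set ℚ_[p] := outer γ⁻¹ \ outer 1

theorem mem_annulus {γ y : ℚ_[p]} (hγ : γ ≠ 0) : y ∈ annulus γ ↔ ‖γ‖ < ‖y‖ ∧ ‖y‖ ≤ 1 := by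
  have : 0 < ‖γ‖ := norm_pos_iff.2 hγ
  simp [annulus, outer, lt_inv_mul_iff₀ this]

theorem isClopen_annulus (γ : ℚ_[p]) : IsClopen (annulus γ) :=
  IsClopen.diff ⟨isClosed_outer _, isOpen_outer _⟩ ⟨isClosed_outer _, isOpen_outer _⟩

theorem zero_notMem_annulus (γ : ℚ_[p]) : (0 : ℚ_[p]) ∉ annulus γ :=
  fun h => zero_notMem_outer _ h.1

theorem chi_mul_eq_one_of_mem_annulus {γ s y : ℚ_[p]} (hs : ‖s‖ ≤ 1) (hy : y ∈ annulus γ) :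
    chi (s * y) = 1 :=
  chi_mul_eq_one_of_notMem_outer fun h => hy.2 (outer_subset_outer (by simpa using hs) h)

/-- The image of the fundamental domain under the multiplication by `γ ^ j`. -/
def shell (γ : ℚ_[p]) (j : ℤ) : Set ℚ_[p] := ((γ ^ j)⁻¹ * ·) ⁻¹' annulus γ

theorem mem_shell {γ y : ℚ_[p]} (hγ : γ ≠ 0) {j : ℤ} :
    y ∈ shell γ j ↔ ‖γ‖ ^ (j + 1) < ‖y‖ ∧ ‖y‖ ≤ ‖γ‖ ^ j := by
  have : 0 < ‖γ‖ := norm_pos_iff.2 hγ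
  have h2 : 0 < ‖γ‖ ^ j := zpow_pos this _
  rw [shell, Set.mem_preimage, mem_annulus hγ, norm_mul, norm_inv, norm_zpow,
    lt_inv_mul_iff₀ h2, inv_mul_le_iff₀ h2, mul_one, zpow_add_one₀ this.ne']

theorem iUnion_shell {γ : ℚ_[p]} (hγ : γ ≠ 0) (hγ₁ : ‖γ‖ < 1) : ⋃ j, shell γ j = {0}ᶜ := by
  have hγ0 : 0 < ‖γ‖ := norm_pos_iff.2 hγ
  ext y
  simp only [Set.mem_iUnion, mem_shell hγ, Set.mem_compl_iff, Set.mem_singleton_iff]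
  constructor
  · rintro ⟨j, hj, -⟩ rfl
    exact (zpow_pos hγ0 (j + 1)).not_gt (by simpa using hj)
  · intro hy
    obtain ⟨n, h1, h2⟩ := exists_mem_Ioc_zpow (norm_pos_iff.2 hy)
      ((one_lt_inv₀ hγ0).2 hγ₁)
    refine ⟨-(n + 1), ?_, ?_⟩
    · simpa using h1
    · simpa [zpow_neg] using h2

theorem pairwise_disjoint_shell {γ : ℚ_[p]} (hγ : γ ≠ 0) (hγ₁ : ‖γ‖ < 1) :
    Pairwise (Function.onFun Disjoint (shell γ)) := by
  have hγ0 : 0 < ‖γ‖ := norm_pos_iff.2 hγ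
  have key : ∀ i j : ℤ, i < j → Disjoint (shell γ i) (shell γ j) := by
    intro i j hij
    refine Set.disjoint_left.2 fun y hi hj => ?_
    rw [mem_shell hγ] at hi hj
    have : ‖γ‖ ^ j ≤ ‖γ‖ ^ (i + 1) := zpow_le_zpow_right_of_le_one₀ hγ0 hγ₁.le (by omega)
    linarith [hi.1, hj.2]
  intro i j hij
  rcases lt_or_gt_of_ne hij with h | h
  · exact key i j h
  · exact (key j i h).symm

variable [MeasurableSpace ℚ_[p]]

/-- The measure `β ^ (-m) • (γ ^ m)_* μ`. -/
def dilate (β : ℝ) (γ : ℚ_[p]) (m : ℤ) (μ : Measure ℚ_[p]) : Measure ℚ_[p] :=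
  ENNReal.ofReal (β ^ (-m)) • μ.map (γ ^ m * ·)

instance (β : ℝ) (γ : ℚ_[p]) (m : ℤ) (μ : Measure ℚ_[p]) [IsFiniteMeasure μ] :
    IsFiniteMeasure (dilate β γ m μ) := by
  unfold dilate
  exact Measure.smul_finite _ ENNReal.ofReal_ne_top

variable [BorelSpace ℚ_[p]]

theorem measurableSet_annulus (γ : ℚ_[p]) : MeasurableSet (annulus γ) :=
  (measurableSet_outer _).diff (measurableSet_outer _)

theorem measurableSet_shell (γ : ℚ_[p]) (j : ℤ) : MeasurableSet (shell γ j) :=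
  (measurableSet_annulus γ).preimage (by fun_prop)

theorem dilate_apply (β : ℝ) (γ : ℚ_[p]) (m : ℤ) (μ : Measure ℚ_[p]) {s : Set ℚ_[p]}
    (hs : MeasurableSet s) :
    dilate β γ m μ s = ENNReal.ofReal (β ^ (-m)) * μ ((γ ^ m * ·) ⁻¹' s) := by
  rw [dilate, Measure.smul_apply, Measure.map_apply (by fun_prop) hs, smul_eq_mul]

theorem dilate_dilate {β : ℝ} (hβ : 0 < β) {γ : ℚ_[p]} (hγ : γ ≠ 0) (i j : ℤ)
    (μ : Measure ℚ_[p]) : dilate β γ i (dilate β γ j μ) = dilate β γ (i + j) μ := by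
  ext s hs
  rw [dilate_apply _ _ _ _ hs, dilate_apply _ _ _ _ (hs.preimage (by fun_prop)),
    dilate_apply _ _ _ _ hs, ← mul_assoc, ← ENNReal.ofReal_mul (by positivity),
    ← zpow_add₀ hβ.ne', neg_add, ← Set.preimage_comp]
  congr 3
  ext x
  simp [zpow_add₀ hγ, mul_assoc]

theorem dilate_restrict_annulus (β : ℝ) {γ : ℚ_[p]} (hγ : γ ≠ 0) (j : ℤ) (μ : Measure ℚ_[p]) :
    dilate β γ j (μ.restrict (annulus γ)) = (dilate β γ j μ).restrict (shell γ j) := by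
  have hpre : (γ ^ j * ·) ⁻¹' shell γ j = annulus γ := by
    rw [shell, ← Set.preimage_comp]
    convert Set.preimage_id using 2
    ext x
    simp [inv_mul_cancel_left₀ (zpow_ne_zero j hγ)]
  rw [dilate, dilate, Measure.restrict_smul, Measure.restrict_map (by fun_prop)
    (measurableSet_shell γ j), hpre]

theorem levyExponent_dilate {β : ℝ} (hβ : 0 < β) (γ : ℚ_[p]) (m : ℤ) (μ : Measure ℚ_[p])
    (t : ℚ_[p]) :
    levyExponent (dilate β γ m μ) t = (β ^ (-m) : ℝ) * levyExponent μ (t * γ ^ m) := by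
  rw [levyExponent, dilate, integral_smul_measure, integral_map (by fun_prop)
    (Measurable.aestronglyMeasurable (by fun_prop)), ENNReal.toReal_ofReal (by positivity),
    Complex.real_smul, levyExponent]
  simp [mul_assoc]

/-- The integral of a character outside a ball in terms of the Lévy exponent. -/
theorem setIntegral_outer_chi (μ : Measure ℚ_[p]) [IsFiniteMeasure μ] (s c : ℚ_[p]) :
    ∫ y in outer c, chi (s * y) ∂μ
      = levyExponent μ s - ∫ u, levyExponent μ (s + c * u) ∂(unitHaar p) := by
  have h := integral_charFn_unitHaar μ s c 0
  have hcompl : {y : ℚ_[p] | ‖c * (y - 0)‖ ≤ 1} = (outer c)ᶜ := by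
    ext; simp [outer]
  simp only [mul_zero, neg_zero, chi_zero, one_mul] at h
  rw [hcompl] at h
  have hadd := integral_add_compl (measurableSet_outer c) (integrable_chi_mul μ s)
  have hint : Integrable (fun u => charFn μ (s + c * u)) (unitHaar p) := by
    have := (continuous_charFn μ).measurable
    exact Integrable.of_bound (Measurable.aestronglyMeasurable (by fun_prop)) _
      (.of_forall fun u => norm_charFn_le μ _)
  -- Passing from characteristic functions to exponents subtracts the total mass from both terms, so
  -- it cancels.
  simp only [levyExponent_eq_charFn_sub]
  rw [integral_sub hint (integrable_const _), h, charFn, ← hadd]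
  simp

theorem measureReal_outer (μ : Measure ℚ_[p]) [IsFiniteMeasure μ] (c : ℚ_[p]) :
    (μ.real (outer c) : ℂ) = -∫ u, levyExponent μ (c * u) ∂(unitHaar p) := by
  have h := setIntegral_outer_chi μ 0 c
  simpa [levyExponent] using h

theorem integrable_unitHaar_of_continuous {f : ℚ_[p] → ℝ} (hf : Continuous f) :
    Integrable f (unitHaar p) :=
  hf.continuousOn.integrableOn_compact (isCompact_closedBall _ _)

end

/-! ### Measures generated by their restriction to an annulus -/

section

/-- The majorant for sums over shells: shells with `j ≥ J` are too close to 0 to contribute, and as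
`j → -∞` the weights `β ^ (-j)` decay geometrically. -/
theorem summable_ite_lt_zpow_neg {β : ℝ} (hβ₀ : 0 < β) (hβ₁ : β < 1) (J : ℤ) :
    Summable fun j : ℤ => if j < J then β ^ (-j) else 0 := by
  refine Summable.of_nat_of_neg ?_ ?_
  · refine summable_of_hasFiniteSupport ((Set.finite_lt_nat J.toNat).subset fun n hn => ?_)
    by_contra h
    simp only [Set.mem_ofPred_eq, not_lt, Int.toNat_le] at h
    simp [not_lt.2 h] at hn
  · refine Summable.of_nonneg_of_le (fun n => ?_) (fun n => ?_)
      (summable_geometric_of_lt_one hβ₀.le hβ₁)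
    · split_ifs <;> positivity
    · split_ifs
      · simp
      · positivity

variable {p : ℕ} [Fact p.Prime]

theorem exists_forall_norm_mul_zpow_le_one {γ : ℚ_[p]} (hγ : γ ≠ 0) (hγ₁ : ‖γ‖ < 1) (c : ℚ_[p]) :
    ∃ J : ℤ, ∀ j, J ≤ j → ‖c * γ ^ j‖ ≤ 1 := by
  have hγ0 : 0 < ‖γ‖ := norm_pos_iff.2 hγ
  obtain ⟨N, hN⟩ := exists_pow_lt_of_lt_one (y := ‖γ‖) (inv_pos.2 (by positivity : 0 < ‖c‖ + 1)) hγ₁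
  refine ⟨N, fun j hj => ?_⟩
  have h1 : ‖γ‖ ^ j ≤ (‖c‖ + 1)⁻¹ := by
    refine (zpow_le_zpow_right_of_le_one₀ hγ0 hγ₁.le hj).trans ?_
    simpa using hN.le
  rw [norm_mul, norm_zpow]
  calc ‖c‖ * ‖γ‖ ^ j ≤ (‖c‖ + 1) * (‖c‖ + 1)⁻¹ := by gcongr; linarith
    _ = 1 := mul_inv_cancel₀ (by positivity)

variable [MeasurableSpace ℚ_[p]]

theorem levyExponent_eq_zero_of_annulus {ν : Measure ℚ_[p]} {γ s : ℚ_[p]}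
    (hν : ν (annulus γ)ᶜ = 0) (hs : ‖s‖ ≤ 1) : levyExponent ν s = 0 := by
  refine integral_eq_zero_of_ae ?_
  have : ∀ᵐ y ∂ν, y ∈ annulus γ := hν
  filter_upwards [this] with y hy
  simp [chi_mul_eq_one_of_mem_annulus hs hy]

theorem norm_levyExponent_le (ν : Measure ℚ_[p]) [IsFiniteMeasure ν] (s : ℚ_[p]) :
    ‖levyExponent ν s‖ ≤ 2 * ν.real Set.univ := by
  refine norm_integral_le_of_norm_le_const (.of_forall fun y => ?_)
  refine (norm_sub_le _ _).trans ?_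
  simp; norm_num

/-- The sum of all dilates of a measure. -/
def spread (β : ℝ) (γ : ℚ_[p]) (ν : Measure ℚ_[p]) : Measure ℚ_[p] :=
  Measure.sum fun j : ℤ => dilate β γ j ν

variable [BorelSpace ℚ_[p]]

theorem spread_apply (β : ℝ) (γ : ℚ_[p]) (ν : Measure ℚ_[p]) {s : Set ℚ_[p]}
    (hs : MeasurableSet s) :
    spread β γ ν s = ∑' j : ℤ, ENNReal.ofReal (β ^ (-j)) * ν ((γ ^ j * ·) ⁻¹' s) := by
  simp only [spread, Measure.sum_apply _ hs, dilate_apply _ _ _ _ hs]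

/-- Multiplication by `γ` shifts the index of the dilates by one, and the change of weight is the
factor `β`. -/
theorem scalingRelation_spread {β : ℝ} (hβ : 0 < β) {γ : ℚ_[p]} (hγ : γ ≠ 0) (ν : Measure ℚ_[p]) :
    ScalingRelation (spread β γ ν) β γ := by
  intro M _ hMo _
  have hγM : MeasurableSet (γ • M) := (hMo.smul₀ hγ).measurableSet
  rw [spread_apply _ _ _ hMo.measurableSet, spread_apply _ _ _ hγM, ← ENNReal.tsum_mul_left,
    ← (Equiv.addRight (1 : ℤ)).tsum_eq fun j => ENNReal.ofReal β *
      (ENNReal.ofReal (β ^ (-j)) * ν ((γ ^ j * ·) ⁻¹' (γ • M)))]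
  congr with j
  have hpre : (γ ^ (j + 1) * ·) ⁻¹' (γ • M) = (γ ^ j * ·) ⁻¹' M := by
    ext x
    simp only [Set.mem_preimage, Set.mem_smul_set_iff_inv_smul_mem₀ hγ, smul_eq_mul]
    rw [zpow_add_one₀ hγ, mul_comm (γ ^ j), mul_assoc, inv_mul_cancel_left₀ hγ]
  rw [Equiv.coe_addRight, hpre, ← mul_assoc, ← ENNReal.ofReal_mul hβ.le]
  congr 2
  rw [neg_add, zpow_add₀ hβ.ne', zpow_neg_one, mul_comm, inv_mul_cancel_right₀ hβ.ne']

theorem IsSymm.spread {ν : Measure ℚ_[p]} (h : IsSymm ν) (β : ℝ) (γ : ℚ_[p]) :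
    IsSymm (spread β γ ν) := by
  intro M hM
  rw [spread_apply _ _ _ hM, spread_apply _ _ _ hM.neg]
  congr with j
  rw [← h _ (hM.preimage (by fun_prop : Measurable (γ ^ j * ·)))]
  congr 2
  ext x
  simp

/-- Only the dilates with `j < J` reach outside a given ball around 0, and their masses are
summable. -/
theorem isLevyMeasure_spread {β : ℝ} (hβ₀ : 0 < β) (hβ₁ : β < 1) {γ : ℚ_[p]} (hγ : γ ≠ 0)
    (hγ₁ : ‖γ‖ < 1) {ν : Measure ℚ_[p]} [IsFiniteMeasure ν] (hν : ν (annulus γ)ᶜ = 0) :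
    IsLevyMeasure (spread β γ ν) := by
  constructor
  · rw [spread_apply _ _ _ (measurableSet_singleton 0), ENNReal.tsum_eq_zero]
    intro j
    rw [measure_mono_null (t := (annulus γ)ᶜ) _ hν, mul_zero]
    intro x hx
    have : x = 0 := by simpa [zpow_ne_zero j hγ] using hx
    rw [this]
    exact zero_notMem_annulus γ
  · intro U hU
    obtain ⟨s, ⟨a, c, hc, rfl⟩, h0, hsU⟩ := exists_mem_ballSystem_subset isOpen_interior
      (mem_interior_iff_mem_nhds.2 hU)
    have hsub : Uᶜ ⊆ outer c := by
      intro y hy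
      by_contra hyc
      refine hy (interior_subset (hsU ?_))
      rw [IsUltrametricDist.closedBall_eq_of_mem (mem_of_mem_nhds h0),
        ← setOf_norm_mul_sub_le_one hc]
      simpa [outer] using hyc
    refine (measure_mono hsub).trans_lt ?_
    obtain ⟨J, hJ⟩ := exists_forall_norm_mul_zpow_le_one hγ hγ₁ c
    rw [spread_apply _ _ _ (measurableSet_outer c)]
    have hle : ∀ j : ℤ, ENNReal.ofReal (β ^ (-j)) * ν ((γ ^ j * ·) ⁻¹' outer c)
        ≤ ENNReal.ofReal ((if j < J then β ^ (-j) else 0) * ν.real Set.univ) := by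
      intro j
      split_ifs with hj
      · rw [ENNReal.ofReal_mul (by positivity), ofReal_measureReal]
        gcongr
        exact Set.subset_univ _
      · rw [measure_mono_null (t := (annulus γ)ᶜ) _ hν]
        · simp
        · intro x hx hxa
          refine hxa.2 (outer_subset_outer (s := c * γ ^ j) ?_ ?_)
          · simpa using hJ j (not_lt.1 hj)
          · simpa [outer, mul_assoc] using hx
    refine (ENNReal.tsum_le_tsum hle).trans_lt ?_
    rw [← ENNReal.ofReal_tsum_of_nonneg]
    · exact ENNReal.ofReal_lt_top
    · intro j
      split_ifs <;> positivity
    · exact (summable_ite_lt_zpow_neg hβ₀ hβ₁ J).mul_right _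

theorem IsLevyMeasure.integrable_chi_sub_one {Φ : Measure ℚ_[p]} (hΦ : IsLevyMeasure Φ)
    (t : ℚ_[p]) : Integrable (fun y => chi (t * y) - 1) Φ := by
  have hfin : IsFiniteMeasure (Φ.restrict (outer t)) :=
    ⟨by rw [Measure.restrict_apply_univ]; exact hΦ.outer_lt_top t⟩
  rw [← integrableOn_iff_integrable_of_support_subset (s := outer t)]
  · exact (integrable_chi_mul (Φ.restrict (outer t)) t).sub (integrable_const _)
  · intro y hy
    by_contra h
    exact hy (by simp [chi_mul_eq_one_of_notMem_outer h])

theorem hasSum_levyExponent_spread {β : ℝ} {γ : ℚ_[p]} {ν : Measure ℚ_[p]}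
    (h : IsLevyMeasure (spread β γ ν)) (t : ℚ_[p]) :
    HasSum (fun j => levyExponent (dilate β γ j ν) t) (levyExponent (spread β γ ν) t) :=
  hasSum_integral_measure (h.integrable_chi_sub_one t)

theorem hasSum_levyExponent_restrict_shell {γ : ℚ_[p]} (hγ : γ ≠ 0) (hγ₁ : ‖γ‖ < 1)
    (μ : Measure ℚ_[p]) [IsFiniteMeasure μ] (t : ℚ_[p]) :
    HasSum (fun j => levyExponent (μ.restrict (shell γ j)) t) (levyExponent μ t) := by
  have h := hasSum_integral_iUnion (μ := μ) (f := fun y => chi (t * y) - 1)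
    (measurableSet_shell γ) (pairwise_disjoint_shell hγ hγ₁)
    ((integrable_chi_mul μ t).sub (integrable_const _)).integrableOn
  rw [iUnion_shell hγ hγ₁, setIntegral_chi_sub_one] at h
  · exact h
  · intro y hy h0
    rw [Set.mem_singleton_iff.1 h0] at hy
    exact zero_notMem_outer t hy

/-- Bounded measures on the annulus whose characteristic functions converge have a limit. -/
theorem exists_measure_annulus_of_tendsto_charFn {γ : ℚ_[p]} {ν : ℕ → Measure ℚ_[p]}
    [∀ n, IsFiniteMeasure (ν n)] (hν : ∀ n, ν n (annulus γ)ᶜ = 0) {C : ℝ}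
    (hC : ∀ n, (ν n).real Set.univ ≤ C) {L : ℚ_[p] → ℂ}
    (hL : ∀ s, Tendsto (fun n => charFn (ν n) s) atTop (𝓝 (L s))) :
    ∃ ν' : Measure ℚ_[p], IsFiniteMeasure ν' ∧ ν' (annulus γ)ᶜ = 0 ∧ ∀ s, charFn ν' s = L s := by
  have hC0 : 0 ≤ C := measureReal_nonneg.trans (hC 0)
  set D : ℝ := C + 1 with hD
  have hD0 : 0 < D := by positivity
  have hmass : ∀ n, 0 ≤ D - (ν n).real Set.univ := fun n => by linarith [hC n]
  -- Each measure is padded by an atom at 0 to the common mass `D` and normalized, so that the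
  -- continuity theorem for probability measures applies. The atom lies off the annulus and is
  -- removed at the end; `D = C + 1` is positive even if `C = 0`.
  let N : ℕ → Measure ℚ_[p] := fun n =>
    ENNReal.ofReal D⁻¹ • (ν n + ENNReal.ofReal (D - (ν n).real Set.univ) • Measure.dirac 0)
  have hNint : ∀ n (f : ℚ_[p] → ℂ), Integrable f (ν n) →
      ∫ y, f y ∂N n = (D⁻¹ : ℝ) * (∫ y, f y ∂ν n + (D - (ν n).real Set.univ : ℝ) * f 0) := by
    intro n f hf
    have hdir : Integrable f (ENNReal.ofReal (D - (ν n).real Set.univ) • Measure.dirac 0) :=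
      (integrable_dirac (by simp)).smul_measure ENNReal.ofReal_ne_top
    rw [integral_smul_measure, integral_add_measure hf hdir, integral_smul_measure,
      ENNReal.toReal_ofReal (by positivity), ENNReal.toReal_ofReal (hmass n), integral_dirac,
      Complex.real_smul, Complex.real_smul]
  have hNprob : ∀ n, IsProbabilityMeasure (N n) := fun n => ⟨by
    simp only [N, Measure.smul_apply, Measure.add_apply, smul_eq_mul, measure_univ, mul_one]
    rw [← ofReal_measureReal, ← ENNReal.ofReal_add measureReal_nonneg (hmass n),
      ← ENNReal.ofReal_mul (by positivity)]
    simp [hD0.ne']⟩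
  -- Characters with `‖s‖ ≤ 1` are trivial on the annulus, so the limit is constant near 0 and its
  -- continuity there is free.
  have hLs : ∀ s, ‖s‖ ≤ 1 → L s = L 0 := by
    intro s hs
    refine tendsto_nhds_unique (hL s) ((hL 0).congr fun n => ?_)
    have h0 := levyExponent_eq_zero_of_annulus (hν n) hs
    rw [levyExponent_eq_charFn_sub, sub_eq_zero] at h0
    rw [h0, charFn_zero_eq]
  let h : ℚ_[p] → ℂ := fun s => (D⁻¹ : ℝ) * (L s + (D - L 0))
  have hh : ContinuousAt h 0 := by
    refine (continuousAt_const (y := h 0)).congr ?_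
    filter_upwards [Metric.closedBall_mem_nhds (0 : ℚ_[p]) one_pos] with s hs
    simp [h, hLs s (by simpa using hs)]
  have hlim : ∀ s, Tendsto (fun n => charFn (N n) s) atTop (𝓝 (h s)) := by
    intro s
    have h0 := hL 0
    simp only [charFn_zero_eq] at h0
    refine (((hL s).add (h0.const_sub (D : ℂ))).const_mul ((D⁻¹ : ℝ) : ℂ)).congr fun n => ?_
    rw [charFn, charFn, hNint n _ (integrable_chi_mul _ s)]
    simp
  obtain ⟨ν₀, -, hν₀⟩ := exists_tendsto_of_tendsto_charFn
    (μ := fun n => (⟨N n, hNprob n⟩ : ProbabilityMeasure ℚ_[p])) hh hlim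
  refine ⟨ENNReal.ofReal D • (ν₀ : Measure ℚ_[p]).restrict (annulus γ), ?_, ?_, fun s => ?_⟩
  · exact Measure.smul_finite _ ENNReal.ofReal_ne_top
  · simp [Measure.restrict_apply (measurableSet_annulus γ).compl]
  -- Because the annulus is clopen, the character cut off to it is a legitimate test function for
  -- weak convergence, and it vanishes at the added atom.
  · let F : BoundedContinuousFunction ℚ_[p] ℂ := BoundedContinuousFunction.ofNormedAddCommGroup
      ((annulus γ).indicator fun y => chi (s * y))
      ((isClopen_annulus γ).continuous_indicator (continuous_chi.comp (by fun_prop))) 1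
      (fun y => (norm_indicator_le_norm_self _ _).trans (by simp))
    have h1 := ((ProbabilityMeasure.tendsto_iff_forall_integral_rclike_tendsto ℂ).1 hν₀ F).const_mul
      (D : ℂ)
    have h2 : charFn (ENNReal.ofReal D • (ν₀ : Measure ℚ_[p]).restrict (annulus γ)) s
        = D * ∫ y, F y ∂(ν₀ : Measure ℚ_[p]) := by
      rw [charFn, integral_smul_measure, ENNReal.toReal_ofReal hD0.le, Complex.real_smul,
        ← integral_indicator (measurableSet_annulus γ)]
      rfl
    rw [h2]
    refine tendsto_nhds_unique h1 ((hL s).congr fun n => ?_)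
    have hF : ∀ y, F y = (annulus γ).indicator (fun y => chi (s * y)) y := fun y => rfl
    have h3 : ∫ y, F y ∂ν n = charFn (ν n) s := by
      refine integral_congr_ae ?_
      have : ∀ᵐ y ∂ν n, y ∈ annulus γ := hν n
      filter_upwards [this] with y hy
      rw [hF, Set.indicator_of_mem hy]
    have hF0 : F 0 = 0 := by rw [hF, Set.indicator_of_notMem (zero_notMem_annulus γ)]
    have hDC : (D : ℂ) ≠ 0 := Complex.ofReal_ne_zero.2 hD0.ne'
    have h4 := hNint n F (F.integrable _)
    rw [h3, hF0, mul_zero, add_zero] at h4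
    change charFn (ν n) s = D * ∫ y, F y ∂(N n)
    rw [h4, Complex.ofReal_inv, mul_inv_cancel_left₀ hDC]

end

/-! ### The Lévy measure of a limit distribution -/

section

theorem inv_mul_one_sub_exp_neg_nonneg {x a : ℝ} (hx : 0 < x) (ha : 0 ≤ a) :
    0 ≤ x⁻¹ * (1 - Real.exp (-(x * a))) := by
  have : Real.exp (-(x * a)) ≤ 1 := Real.exp_le_one_iff.2 (neg_nonpos.2 (by positivity))
  have : 0 ≤ 1 - Real.exp (-(x * a)) := by linarith
  positivity

theorem inv_mul_one_sub_exp_neg_le {x : ℝ} (hx : 0 < x) (a : ℝ) :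
    x⁻¹ * (1 - Real.exp (-(x * a))) ≤ a := by
  rw [inv_mul_le_iff₀ hx]
  linarith [Real.add_one_le_exp (-(x * a))]

theorem tendsto_inv_mul_one_sub_exp_neg {β : ℝ} (hβ₀ : 0 < β) (hβ₁ : β < 1) (a : ℝ) :
    Tendsto (fun n : ℕ => (β ^ n)⁻¹ * (1 - Real.exp (-(β ^ n * a)))) atTop (𝓝 a) := by
  have hd : HasDerivAt (fun x : ℝ => 1 - Real.exp (-(x * a))) a 0 := by
    have h := (((hasDerivAt_id (0 : ℝ)).mul_const a).neg.exp).const_sub 1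
    simpa using h
  rw [hasDerivAt_iff_tendsto_slope_zero] at hd
  have hβ : Tendsto (fun n : ℕ => β ^ n) atTop (𝓝[≠] 0) :=
    tendsto_nhdsWithin_iff.2 ⟨tendsto_pow_atTop_nhds_zero_of_lt_one hβ₀.le hβ₁,
      .of_forall fun n => (pow_pos hβ₀ n).ne'⟩
  refine (hd.comp hβ).congr fun n => ?_
  simp

variable {p : ℕ} [Fact p.Prime]

theorem map_mul_zpow {β : ℝ} (hβ₀ : 0 < β) {γ : ℚ_[p]} (hγ : γ ≠ 0) {ψ : ℚ_[p] → ℝ}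
    (h : ∀ t, ψ (t * γ) = β * ψ t) (t : ℚ_[p]) (m : ℤ) : ψ (t * γ ^ m) = β ^ m * ψ t := by
  induction m using Int.induction_on with
  | zero => simp
  | succ n ih => rw [zpow_add_one₀ hγ, ← mul_assoc, h, ih, zpow_add_one₀ hβ₀.ne']; ring
  | pred n ih =>
    have h1 := h (t * γ ^ (-(n : ℤ) - 1))
    rw [mul_assoc, ← zpow_add_one₀ hγ, sub_add_cancel, ih] at h1
    rw [zpow_sub_one₀ hβ₀.ne', mul_right_comm, h1, mul_right_comm, mul_inv_cancel₀ hβ₀.ne', one_mul]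

variable [MeasurableSpace ℚ_[p]] [BorelSpace ℚ_[p]]

/-- A distribution with characteristic function `exp (-ψ)`, where `ψ(γ t) = β ψ(t)`, has a
symmetric Lévy measure with the scaling property. -/
theorem exists_levyMeasure_of_exponent {β : ℝ} (hβ₀ : 0 < β) (hβ₁ : β < 1) {γ : ℚ_[p]}
    (hγ : γ ≠ 0) (hγ₁ : ‖γ‖ < 1) {G : Measure ℚ_[p]} [IsProbabilityMeasure G] {ψ : ℚ_[p] → ℝ}
    (hψc : Continuous ψ) (hψ₀ : ∀ t, 0 ≤ ψ t) (hψ : ∀ t, ψ (t * γ) = β * ψ t)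
    (hG : ∀ t, charFn G t = Real.exp (-ψ t)) :
    ∃ Φ : Measure ℚ_[p], IsLevyMeasure Φ ∧ IsSymm Φ ∧ ScalingRelation Φ β γ ∧
      ∀ t, charFn G t = levyExp Φ t := by
  -- As `m → ∞` the right side tends to `-ψ t`, so the dilates of `G` serve as approximate Lévy
  -- measures.
  have hlog : ∀ (m : ℤ) t, levyExponent (dilate β γ m G) t
      = -(((β ^ m)⁻¹ * (1 - Real.exp (-(β ^ m * ψ t))) : ℝ) : ℂ) := by
    intro m t
    rw [levyExponent_dilate hβ₀, levyExponent_eq_charFn_sub, hG, map_mul_zpow hβ₀ hγ hψ]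
    simp [zpow_neg]
    ring
  have hdom : ∀ s c : ℚ_[p], Integrable (fun u => ψ (s + c * u)) (unitHaar p) := fun s c =>
    integrable_unitHaar_of_continuous (by fun_prop)
  have hnull : ∀ m : ℤ, (dilate β γ m G).restrict (annulus γ) (annulus γ)ᶜ = 0 := fun m => by
    simp [Measure.restrict_apply (measurableSet_annulus γ).compl]
  -- The mass of the dilates on the annulus is bounded.
  have hmass : ∀ m : ℤ, ((dilate β γ m G).restrict (annulus γ)).real Set.univ
      ≤ ∫ u, ψ (γ⁻¹ * u) ∂(unitHaar p) := by
    intro m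
    have h1 := measureReal_outer (dilate β γ m G) γ⁻¹
    simp only [hlog, integral_neg, neg_neg, integral_complex_ofReal, Complex.ofReal_inj] at h1
    calc ((dilate β γ m G).restrict (annulus γ)).real Set.univ
        = (dilate β γ m G).real (annulus γ) := by simp
      _ ≤ (dilate β γ m G).real (outer γ⁻¹) := measureReal_mono Set.sdiff_subset
      _ ≤ _ := by
        rw [h1]
        refine integral_mono_of_nonneg (.of_forall fun u => ?_) (by simpa using hdom 0 γ⁻¹)
          (.of_forall fun u => ?_)
        · exact inv_mul_one_sub_exp_neg_nonneg (zpow_pos hβ₀ m) (hψ₀ _)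
        · exact inv_mul_one_sub_exp_neg_le (zpow_pos hβ₀ m) _
  -- Fourier inversion expresses the part outside a ball through exponents alone, which converge
  -- although the total masses `β⁻ⁿ` blow up.
  have houter : ∀ s c : ℚ_[p], Tendsto
      (fun n : ℕ => ∫ y in outer c, chi (s * y) ∂(dilate β γ (n : ℤ) G)) atTop
      (𝓝 ((-ψ s + ∫ u, ψ (s + c * u) ∂(unitHaar p) : ℝ) : ℂ)) := by
    intro s c
    have h1 : Tendsto (fun n : ℕ => ∫ u, (β ^ n)⁻¹ * (1 - Real.exp (-(β ^ n * ψ (s + c * u))))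
        ∂(unitHaar p)) atTop (𝓝 (∫ u, ψ (s + c * u) ∂(unitHaar p))) := by
      refine tendsto_integral_of_dominated_convergence (fun u => ψ (s + c * u)) (fun n => ?_)
        (hdom s c) (fun n => .of_forall fun u => ?_) (.of_forall fun u => ?_)
      · exact Continuous.aestronglyMeasurable (by fun_prop)
      · rw [Real.norm_of_nonneg (inv_mul_one_sub_exp_neg_nonneg (pow_pos hβ₀ n) (hψ₀ _))]
        exact inv_mul_one_sub_exp_neg_le (pow_pos hβ₀ n) _
      · exact tendsto_inv_mul_one_sub_exp_neg hβ₀ hβ₁ _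
    have h2 := (tendsto_inv_mul_one_sub_exp_neg hβ₀ hβ₁ (ψ s)).neg.add h1
    refine ((Complex.continuous_ofReal.tendsto _).comp h2).congr fun n => ?_
    rw [setIntegral_outer_chi]
    simp only [hlog, integral_neg, integral_complex_ofReal, zpow_natCast, Function.comp_apply]
    push_cast
    ring
  -- The annulus is `outer γ⁻¹` minus `outer 1`, so the limit on it is the difference of two limits
  -- from `houter`.
  set L : ℚ_[p] → ℝ := fun s => (-ψ s + ∫ u, ψ (s + γ⁻¹ * u) ∂(unitHaar p))
    - (-ψ s + ∫ u, ψ (s + 1 * u) ∂(unitHaar p)) with hL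
  have hlim : ∀ s, Tendsto
      (fun n : ℕ => charFn ((dilate β γ (n : ℤ) G).restrict (annulus γ)) s) atTop
      (𝓝 (L s : ℂ)) := by
    intro s
    rw [hL, Complex.ofReal_sub]
    refine ((houter s γ⁻¹).sub (houter s 1)).congr fun n => ?_
    rw [charFn, annulus, setIntegral_sdiff (measurableSet_outer 1)
      (integrable_chi_mul _ s).integrableOn]
    refine outer_subset_outer ?_
    rw [norm_one, norm_inv]
    exact (one_le_inv₀ (norm_pos_iff.2 hγ)).2 hγ₁.le
  obtain ⟨ν, hνfin, hνA, hνL⟩ := exists_measure_annulus_of_tendsto_charFn (γ := γ)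
    (fun n : ℕ => hnull n) (fun n => hmass n) hlim
  have hlevy := isLevyMeasure_spread hβ₀ hβ₁ hγ hγ₁ hνA
  refine ⟨spread β γ ν, hlevy, ?_, scalingRelation_spread hβ₀ hγ ν, fun t => ?_⟩
  · exact (isSymm_of_conj_charFn fun t => by rw [hνL, Complex.conj_ofReal]).spread β γ
  have hlimexp : ∀ s, Tendsto
      (fun m : ℤ => levyExponent ((dilate β γ m G).restrict (annulus γ)) s) atTop
      (𝓝 (levyExponent ν s)) := by
    intro s
    rw [← Nat.map_cast_int_atTop, tendsto_map'_iff]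
    simp only [Function.comp_def, levyExponent_eq_charFn_sub, ← charFn_zero_eq, hνL]
    exact (hlim s).sub (hlim 0)
  -- The piece of the `n`-th dilate on shell `j` is the `j`-th dilate of the annulus piece with
  -- index `n - j`. Since `n - j → ∞` for fixed `j`, every shell converges to the matching dilate of
  -- `ν`.
  have hshell : ∀ (n j : ℤ), levyExponent ((dilate β γ n G).restrict (shell γ j)) t
      = (β ^ (-j) : ℝ) * levyExponent ((dilate β γ (n - j) G).restrict (annulus γ)) (t * γ ^ j) := by
    intro n j
    rw [← levyExponent_dilate hβ₀, dilate_restrict_annulus β hγ, dilate_dilate hβ₀ hγ,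
      add_sub_cancel]
  obtain ⟨J, hJ⟩ := exists_forall_norm_mul_zpow_le_one hγ hγ₁ t
  set C : ℝ := ∫ u, ψ (γ⁻¹ * u) ∂(unitHaar p) with hC
  have hT : Tendsto (fun n : ℕ => ∑' j : ℤ, levyExponent ((dilate β γ n G).restrict (shell γ j)) t)
      atTop (𝓝 (∑' j : ℤ, levyExponent (dilate β γ j ν) t)) := by
    -- For `j ≥ J` the point `tγ^j` lies in the unit ball and the term is 0; otherwise the exponent
    -- is at most twice the mass, and `C` bounds the mass uniformly in `n`.
    refine tendsto_tsum_of_dominated_convergence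
      (bound := fun j : ℤ => (if j < J then β ^ (-j) else 0) * (2 * C))
      ((summable_ite_lt_zpow_neg hβ₀ hβ₁ J).mul_right _) (fun j => ?_)
      (.of_forall fun n j => ?_)
    · simp only [hshell, levyExponent_dilate hβ₀]
      refine ((hlimexp (t * γ ^ j)).comp ?_).const_mul _
      exact tendsto_atTop_add_const_right _ (-j) tendsto_natCast_atTop_atTop
    · rw [hshell, norm_mul, Complex.norm_real, Real.norm_of_nonneg (by positivity)]
      split_ifs with hj
      · gcongr
        exact (norm_levyExponent_le _ _).trans (by gcongr; exact hmass _)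
      · rw [levyExponent_eq_zero_of_annulus (hnull _) (hJ j (not_lt.1 hj))]
        simp
  have hsum : levyExponent (spread β γ ν) t = -(ψ t : ℂ) := by
    rw [← (hasSum_levyExponent_spread hlevy t).tsum_eq]
    -- Summed over all shells, the left side of `hT` is the full exponent of the `n`-th dilate of
    -- `G`, which tends to `-ψ t`.
    refine tendsto_nhds_unique hT ?_
    simp only [(hasSum_levyExponent_restrict_shell hγ hγ₁ _ t).tsum_eq, hlog, zpow_natCast]
    exact ((Complex.continuous_ofReal.tendsto _).comp
      (tendsto_inv_mul_one_sub_exp_neg hβ₀ hβ₁ (ψ t))).neg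
  rw [levyExp_eq, hsum, hG]
  push_cast
  rfl

end

end PadicLimit

end

theorem theorem1 {p : ℕ} [Fact p.Prime] [MeasurableSpace ℚ_[p]] [BorelSpace ℚ_[p]]
    (β : ℝ) (hβ₀ : 0 < β) (hβ₁ : β < 1)
    (γ₀ : ℚ_[p]) (hγ₀ : γ₀ ≠ 0) (hγ₁ : ‖γ₀‖ ≤ (p : ℝ)⁻¹) :
    (∀ Φ : Measure ℚ_[p], PadicLimit.IsLevyMeasure Φ → PadicLimit.ScalingRelation Φ β γ₀ →
      ∃ (G : Measure ℚ_[p]) (_ : IsProbabilityMeasure G),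
        (∀ t, PadicLimit.charFn G t = PadicLimit.levyExp Φ t) ∧
        ∃ (Ω : Type) (_ : MeasurableSpace Ω) (P : Measure Ω) (_ : IsProbabilityMeasure P)
          (X : ℕ → Ω → ℚ_[p]) (B : ℕ → ℚ_[p]) (k : ℕ → ℕ),
          PadicLimit.IsIID P X ∧ (∀ n, B n ≠ 0) ∧ (∀ n, 0 < k n) ∧ StrictMono k ∧
          Tendsto (fun n => (k n : ℝ) / (k (n + 1) : ℝ)) atTop (𝓝 β) ∧
          Tendsto (fun n => B n / B (n + 1)) atTop (𝓝 γ₀) ∧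
          PadicLimit.SumsConvergeTo P X B k G) ∧
    (∀ (Ω : Type*) [MeasurableSpace Ω] (P : Measure Ω) [IsProbabilityMeasure P]
      (X : ℕ → Ω → ℚ_[p]) (B : ℕ → ℚ_[p]) (k : ℕ → ℕ)
      (G : Measure ℚ_[p]) [IsProbabilityMeasure G],
      PadicLimit.IsIID P X → (∀ i, PadicLimit.IsSymm (P.map (X i))) →
      (∀ n, B n ≠ 0) → (∀ n, 0 < k n) → Monotone k →
      Tendsto (fun n => ‖B n‖) atTop atTop →
      Tendsto (fun n => (k n : ℝ) / (k (n + 1) : ℝ)) atTop (𝓝 β) →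
      Tendsto (fun n => B n / B (n + 1)) atTop (𝓝 γ₀) →
      PadicLimit.SumsConvergeTo P X B k G →
      ∃ Φ : Measure ℚ_[p], PadicLimit.IsLevyMeasure Φ ∧ PadicLimit.IsSymm Φ ∧
        PadicLimit.ScalingRelation Φ β γ₀ ∧
        ∀ t, PadicLimit.charFn G t = PadicLimit.levyExp Φ t) := by
  refine ⟨fun Φ hΦ hs => PadicLimit.exists_sumsConvergeTo hβ₀ hβ₁ hγ₀ hΦ hs, ?_⟩
  intro Ω _ P _ X B k G _ hX hsymm hB hk _ hBtop hρ hγ h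
  have hγ₁' : ‖γ₀‖ < 1 :=
    hγ₁.trans_lt (inv_lt_one_of_one_lt₀ (by exact_mod_cast (Fact.out : p.Prime).one_lt))
  obtain ⟨ψ, hψc, hψ₀, hψ, hG⟩ := h.exists_exponent hβ₀ hγ₁' hX hsymm hB hk hBtop hρ hγ
  exact PadicLimit.exists_levyMeasure_of_exponent hβ₀ hβ₁ hγ₀ hγ₁' hψc hψ₀ hψ hG
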